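/- All vector spaces are complex. An operator space is a vector space $V$ with a norm on each matrix space $M_n(V)$, $n\in\mathbb N$, such that (M1) $\|v\oplus w\|=\max\{\|v\|,\|w\|\}$ and (M2) $\|\alpha v\beta\|\le\|\alpha\|\|v\|\|\beta\|$ for scalar matrices $\alpha,\beta$ with their operator norms; such a family of norms is called an operator space matrix norm. Below, $V,W,X,Y,U_1,U_2$ denote operator spaces that are complete. For a linear map $r$, $\|r\|_{cb}=\sup_m\|r_m\|$, where $r_m$ applies $r$ entrywise to $M_m$, and $r\in\mathcal{CB}$ if this is finite; $V^*$ has the operator space structure $M_n(V^*)=\mathcal{CB}(V,M_n)$. For a bilinear $\phi:V\times W\to X$, $\|\phi\|_{jcb}=\sup_m\|\phi_m\|$ with $\phi_m:M_m(V)\times M_m(W)\to M_{m^2}(X)$, $\phi_m(v,w)=(\phi(v_{ij},w_{kl}))$; $\mathcal{JCB}(V\times W,X)$ is the space of all $\phi$ with $\|\phi\|_{jcb}<\infty$, with $M_n(\mathcal{JCB}(V\times W,X))=\mathcal{JCB}(V\times W,M_n(X))$. The operator space projective tensor product $V\widehat\otimes W$ is the completion of $V\otimes W$ for the matrix norms $\|u\|_\wedge=\inf\{\|\alpha\|\|v\|\|w\|\|\beta\|:u=\alpha(v\otimes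 w)\beta\}$, where $v\in M_p(V)$, $w\in M_q(W)$ and $\alpha,\beta$ are scalar matrices. An operator space bilinear ideal $\mathfrak A$ assigns to all $V,W,X$ a linear subspace $\mathfrak A(V\times W,X)$ of $\mathcal{JCB}(V\times W,X)$ that contains all finite type maps $(v,w)\mapsto\sum_i f_i(v)g_i(w)x_i$ (finite sums, $f_i\in V^*$, $g_i\in W^*$, $x_i\in X$), together with an operator space matrix norm $\|\cdot\|_{\mathfrak A}$ on it, such that for all $n$ and all $\phi\in M_n(\mathfrak A(V\times W,X))$: (a) $\|\phi\|_{jcb}\le\|\phi\|_{\mathfrak A}$; (b) for $r_1\in\mathcal{CB}(U_1,V)$, $r_2\in\mathcal{CB}(U_2,W)$, $s\in\mathcal{CB}(X,Y)$ the matrix $s_n\circ\phi\circ(r_1,r_2)$ belongs to $M_n(\mathfrak A(U_1\times U_2,Y))$ and $\|s_n\circ\phi\circ(r_1,r_2)\|_{\mathfrak A}\le\|s\|_{cb}\|\phi\|_{\mathfrak A}\|r_1\|_{cb}\|r_2\|_{cb}$. Let $\Psi:(V^*\widehat\otimes W^*)\widehat\otimes X\to\mathcal{JCB}(V\times W,X)$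 be the canonical continuous linear map with $\Psi((f\otimes g)\otimes x)(v,w)=f(v)g(w)x$. The space $\mathcal N(V\times W,X)$ of completely nuclear bilinear maps is the image of $\Psi$, with the quotient matrix norm $\|\cdot\|_{\mathcal N}$ of $((V^*\widehat\otimes W^*)\widehat\otimes X)/\ker\Psi$. For a matrix $\phi$ of jointly completely bounded bilinear maps put $\|\phi\|_{\mathcal I}=\sup\|\phi|_{F_1\times F_2}\|_{\mathcal N}$, the supremum over all finite-dimensional subspaces $F_1\subset V$, $F_2\subset W$; the space $\mathcal I(V\times W,X)$ of completely integral bilinear maps consists of those $\phi\in\mathcal{JCB}(V\times W,X)$ with $\|\phi\|_{\mathcal I}<\infty$, with the matrix norm $\|\cdot\|_{\mathcal I}$. Then: (1) $\mathcal N$ is an operator space bilinear ideal. (2) $\mathcal I$ is an operator space bilinear ideal. (3) $\mathcal N(V\times W,X)\subset\mathcal I(V\times W,X)$, and for every $n$ and every $\phi\in M_n(\mathcal N(V\times W,X))$ one has $\|\phi\|_{jcb}\le\|\phi\|_{\mathcal I}\le\|\phi\|_{\mathcal N}<\infty$. The inequality $\|\phi\|_{jcb}\le\|\phi\|_{\mathcal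 I}<\infty$ also holds for every $\phi\in M_n(\mathcal I(V\times W,X))$. -/

import Mathlib

set_option linter.unusedSectionVars false
set_option linter.unusedSimpArgs false

universe u

noncomputable section

namespace OpSp

open Matrix

/-- The norm of a rectangular scalar matrix as an operator `ℓ₂(κ) → ℓ₂(ι)`. -/
def sNorm {ι κ : Type} [Fintype ι] [Fintype κ] (α : Matrix ι κ ℂ) : ℝ :=
  open scoped Matrix.Norms.L2Operator Classical in ‖α‖

/-- The product `α v β` of a matrix `v` over `V` with scalar matrices. -/
def sand {ι κ V : Type*} [Fintype κ] [AddCommGroup V] [Module ℂ V]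
    (α : Matrix ι κ ℂ) (v : Matrix κ κ V) (β : Matrix κ ι ℂ) : Matrix ι ι V :=
  Matrix.of fun i j => ∑ k, ∑ l, (α i k * β l j) • v k l

/-- The diagonal sum `v ⊕ w ∈ M_{n+m}(V)`. -/
def dsum {V : Type*} [Zero V] {n m : ℕ} (v : Matrix (Fin n) (Fin n) V)
    (w : Matrix (Fin m) (Fin m) V) : Matrix (Fin (n + m)) (Fin (n + m)) V :=
  Matrix.reindex finSumFinEquiv finSumFinEquiv (Matrix.fromBlocks v 0 0 w)

/-- A family of seminorms on the spaces `M_n(V)` satisfying the two axioms M1 (the field `dsum`)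
and M2 (the field `sand`). -/
structure IsOperatorSpaceSeminorm {V : Type*} [AddCommGroup V] [Module ℂ V]
    (N : ∀ n : ℕ, Matrix (Fin n) (Fin n) V → ℝ) : Prop where
  add_le : ∀ (n : ℕ) (v w : Matrix (Fin n) (Fin n) V), N n (v + w) ≤ N n v + N n w
  smul : ∀ (n : ℕ) (c : ℂ) (v : Matrix (Fin n) (Fin n) V), N n (c • v) = ‖c‖ * N n v
  dsum : ∀ (n m : ℕ) (v : Matrix (Fin n) (Fin n) V) (w : Matrix (Fin m) (Fin m) V),
    N (n + m) (dsum v w) = max (N n v) (N m w)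
  sand : ∀ (n m : ℕ) (α : Matrix (Fin m) (Fin n) ℂ) (v : Matrix (Fin n) (Fin n) V)
    (β : Matrix (Fin n) (Fin m) ℂ), N m (sand α v β) ≤ sNorm α * N n v * sNorm β

/-- An operator space matrix norm on a complex vector space: a norm on each `M_n(V)`, subject to
M1 and M2. -/
structure IsOperatorSpaceNorm {V : Type*} [AddCommGroup V] [Module ℂ V]
    (N : ∀ n : ℕ, Matrix (Fin n) (Fin n) V → ℝ) : Prop extends IsOperatorSpaceSeminorm N where
  eq_zero : ∀ (n : ℕ) (v : Matrix (Fin n) (Fin n) V), N n v = 0 → v = 0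

/-- An operator space structure on a normed space `V`: matrix norms satisfying M1 and M2 whose
first level is the norm of `V`.  When the norm of `V` is a genuine norm, so are all the matrix
norms, see `OperatorSpace.isOperatorSpaceNorm`.  Seminormed `V` are allowed only because the
algebraic tensor product is equipped with its matrix norms before it is completed. -/
class OperatorSpace (V : Type*) [SeminormedAddCommGroup V] [NormedSpace ℂ V] where
  mnorm : ∀ n : ℕ, Matrix (Fin n) (Fin n) V → ℝ
  isSeminorm : IsOperatorSpaceSeminorm mnorm
  mnorm_one : ∀ v : Matrix (Fin 1) (Fin 1) V, mnorm 1 v = ‖v 0 0‖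

/-! ### Scalar matrices -/

section Scalar

variable {ι κ μ : Type} [Fintype ι] [Fintype κ] [Fintype μ]

theorem sNorm_nonneg (α : Matrix ι κ ℂ) : 0 ≤ sNorm α := by
  classical
  open scoped Matrix.Norms.L2Operator in exact norm_nonneg α

theorem sNorm_mul (α : Matrix ι κ ℂ) (β : Matrix κ μ ℂ) : sNorm (α * β) ≤ sNorm α * sNorm β := by
  classical
  exact Matrix.l2_opNorm_mul α β

theorem sNorm_conjTranspose (α : Matrix ι κ ℂ) : sNorm αᴴ = sNorm α := by
  classical
  exact Matrix.l2_opNorm_conjTranspose α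

theorem sNorm_sq (α : Matrix ι κ ℂ) : sNorm α * sNorm α = sNorm (αᴴ * α) := by
  classical
  exact (Matrix.l2_opNorm_conjTranspose_mul_self α).symm

theorem sNorm_sq' (α : Matrix ι κ ℂ) : sNorm α * sNorm α = sNorm (α * αᴴ) := by
  have := sNorm_sq αᴴ
  rwa [sNorm_conjTranspose, conjTranspose_conjTranspose] at this

theorem sNorm_add (α β : Matrix ι κ ℂ) : sNorm (α + β) ≤ sNorm α + sNorm β := by
  classical
  open scoped Matrix.Norms.L2Operator in exact norm_add_le α β

theorem sNorm_smul (c : ℂ) (α : Matrix ι κ ℂ) : sNorm (c • α) = ‖c‖ * sNorm α := by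
  classical
  open scoped Matrix.Norms.L2Operator in exact norm_smul c α

theorem sNorm_zero : sNorm (0 : Matrix ι κ ℂ) = 0 := by
  have := sNorm_smul (0 : ℂ) (0 : Matrix ι κ ℂ)
  simpa using this

theorem sum_sq_mulVec_le (α : Matrix ι κ ℂ) (x : κ → ℂ) :
    ∑ i, ‖(α *ᵥ x) i‖ ^ 2 ≤ sNorm α ^ 2 * ∑ k, ‖x k‖ ^ 2 := by
  classical
  have := Matrix.l2_opNorm_mulVec α (WithLp.toLp 2 x)
  have h2 := pow_le_pow_left₀ (norm_nonneg _) this 2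
  rw [mul_pow, EuclideanSpace.norm_sq_eq, EuclideanSpace.norm_sq_eq] at h2
  exact h2

theorem sNorm_le (α : Matrix ι κ ℂ) {C : ℝ} (hC : 0 ≤ C)
    (h : ∀ x : κ → ℂ, ∑ i, ‖(α *ᵥ x) i‖ ^ 2 ≤ C ^ 2 * ∑ k, ‖x k‖ ^ 2) : sNorm α ≤ C := by
  classical
  refine ContinuousLinearMap.opNorm_le_bound _ hC fun x => ?_
  refine le_of_sq_le_sq ?_ (by positivity)
  rw [mul_pow, EuclideanSpace.norm_sq_eq, EuclideanSpace.norm_sq_eq]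
  exact h (WithLp.ofLp x)

theorem sNorm_one_le [DecidableEq ι] : sNorm (1 : Matrix ι ι ℂ) ≤ 1 :=
  sNorm_le _ zero_le_one fun x => by simp

/-- The `0`-`1` matrix with `v.submatrix f f = P v Pᵀ`. -/
def pick [DecidableEq κ] (f : ι → κ) : Matrix ι κ ℂ := fun i k => if f i = k then 1 else 0

theorem pick_mulVec [DecidableEq κ] (f : ι → κ) (x : κ → ℂ) (i : ι) :
    (pick f *ᵥ x) i = x (f i) := by
  simp [pick, mulVec, dotProduct]

theorem sNorm_pick_le [DecidableEq κ] {f : ι → κ} (hf : Function.Injective f) :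
    sNorm (pick f) ≤ 1 := by
  classical
  refine sNorm_le _ zero_le_one fun x => ?_
  simp only [pick_mulVec, one_pow, one_mul]
  rw [← Finset.sum_image (s := Finset.univ) (g := f) (f := fun k => ‖x k‖ ^ 2)
    (fun a _ b _ h => hf h)]
  exact Finset.sum_le_sum_of_subset_of_nonneg (Finset.subset_univ _) fun _ _ _ => by positivity

theorem pick_transpose [DecidableEq κ] (f : ι → κ) : (pick f)ᵀ = (pick f)ᴴ := by
  ext i j
  simp only [pick, transpose_apply, conjTranspose_apply]
  split_ifs <;> simp

theorem sNorm_pickT_le [DecidableEq κ] {f : ι → κ} (hf : Function.Injective f) :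
    sNorm (pick f)ᵀ ≤ 1 := by
  rw [pick_transpose, sNorm_conjTranspose]
  exact sNorm_pick_le hf

theorem sNorm_fromBlocks_le {ι' κ' : Type} [Fintype ι'] [Fintype κ'] (α : Matrix ι κ ℂ)
    (β : Matrix ι' κ' ℂ) : sNorm (fromBlocks α 0 0 β) ≤ max (sNorm α) (sNorm β) := by
  refine sNorm_le _ (le_max_of_le_left (sNorm_nonneg _)) fun x => ?_
  rw [Fintype.sum_sum_type, Fintype.sum_sum_type, mul_add]
  have h1 := sum_sq_mulVec_le α (fun k => x (.inl k))
  have h2 := sum_sq_mulVec_le β (fun k => x (.inr k))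
  have e1 : ∀ i, (fromBlocks α 0 0 β *ᵥ x) (.inl i) = (α *ᵥ fun k => x (.inl k)) i := by
    intro i; simp [mulVec, dotProduct]
  have e2 : ∀ i, (fromBlocks α 0 0 β *ᵥ x) (.inr i) = (β *ᵥ fun k => x (.inr k)) i := by
    intro i; simp [mulVec, dotProduct]
  simp only [e1, e2]
  have a1 : sNorm α ^ 2 ≤ max (sNorm α) (sNorm β) ^ 2 :=
    pow_le_pow_left₀ (sNorm_nonneg _) (le_max_left _ _) 2
  have a2 : sNorm β ^ 2 ≤ max (sNorm α) (sNorm β) ^ 2 :=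
    pow_le_pow_left₀ (sNorm_nonneg _) (le_max_right _ _) 2
  gcongr
  · exact h1.trans (by gcongr)
  · exact h2.trans (by gcongr)

theorem sNorm_kron_one_le [DecidableEq μ] (α : Matrix ι κ ℂ) :
    sNorm (kroneckerMap (· * ·) α (1 : Matrix μ μ ℂ)) ≤ sNorm α := by
  refine sNorm_le _ (sNorm_nonneg _) fun x => ?_
  have e : ∀ i m, (kroneckerMap (· * ·) α (1 : Matrix μ μ ℂ) *ᵥ x) (i, m)
      = (α *ᵥ fun k => x (k, m)) i := by
    intro i m
    simp [mulVec, dotProduct, Fintype.sum_prod_type, Matrix.one_apply]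
  rw [Fintype.sum_prod_type_right, Fintype.sum_prod_type_right, Finset.mul_sum]
  simp only [e]
  exact Finset.sum_le_sum fun m _ => sum_sq_mulVec_le α _

theorem sNorm_submatrix_equiv {ι' κ' : Type} [Fintype ι'] [Fintype κ'] (α : Matrix ι κ ℂ)
    (e : ι' ≃ ι) (f : κ' ≃ κ) : sNorm (α.submatrix e f) ≤ sNorm α := by
  refine sNorm_le _ (sNorm_nonneg _) fun x => ?_
  have h := sum_sq_mulVec_le α (x ∘ f.symm)
  rw [← e.sum_comp, ← f.sum_comp] at h
  simpa [submatrix_mulVec_equiv] using h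

theorem sNorm_submatrix_eq {ι' κ' : Type} [Fintype ι'] [Fintype κ'] (α : Matrix ι κ ℂ)
    (e : ι' ≃ ι) (f : κ' ≃ κ) : sNorm (α.submatrix e f) = sNorm α := by
  refine le_antisymm (sNorm_submatrix_equiv α e f) ?_
  have := sNorm_submatrix_equiv (α.submatrix e f) e.symm f.symm
  simpa [submatrix_submatrix] using this

theorem sNorm_one_kron_le [DecidableEq μ] (α : Matrix ι κ ℂ) :
    sNorm (kroneckerMap (· * ·) (1 : Matrix μ μ ℂ) α) ≤ sNorm α := by
  have e : kroneckerMap (· * ·) (1 : Matrix μ μ ℂ) α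
      = (kroneckerMap (· * ·) α (1 : Matrix μ μ ℂ)).submatrix
        (Equiv.prodComm _ _) (Equiv.prodComm _ _) := by
    ext ⟨a, b⟩ ⟨c, d⟩
    simp [mul_comm]
  rw [e]
  exact (sNorm_submatrix_equiv _ _ _).trans (sNorm_kron_one_le α)

theorem sNorm_kron_le {ι' κ' : Type} [Fintype ι'] [Fintype κ'] (α : Matrix ι κ ℂ)
    (β : Matrix ι' κ' ℂ) : sNorm (kroneckerMap (· * ·) α β) ≤ sNorm α * sNorm β := by
  classical
  have e : kroneckerMap (· * ·) α β = kroneckerMap (· * ·) α (1 : Matrix ι' ι' ℂ)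
      * kroneckerMap (· * ·) (1 : Matrix κ κ ℂ) β := by
    ext ⟨a, b⟩ ⟨c, d⟩
    simp [Matrix.mul_apply, Fintype.sum_prod_type, Matrix.one_apply]
  rw [e]
  refine (sNorm_mul _ _).trans ?_
  exact mul_le_mul (sNorm_kron_one_le α) (sNorm_one_kron_le β) (sNorm_nonneg _) (sNorm_nonneg _)

theorem norm_entry_le_sNorm (α : Matrix ι κ ℂ) (i : ι) (k : κ) : ‖α i k‖ ≤ sNorm α := by
  classical
  have h := sum_sq_mulVec_le α (Pi.single k 1)
  have h1 : ∑ k', ‖(Pi.single k (1 : ℂ) : κ → ℂ) k'‖ ^ 2 = 1 := by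
    rw [Finset.sum_eq_single k] <;> simp +contextual [Pi.single_apply]
  rw [h1, mul_one] at h
  have h2 : ‖α i k‖ ^ 2 ≤ ∑ i, ‖(α *ᵥ (Pi.single k 1)) i‖ ^ 2 := by
    have := Finset.single_le_sum (f := fun i => ‖(α *ᵥ (Pi.single k 1)) i‖ ^ 2)
      (fun _ _ => by positivity) (Finset.mem_univ i)
    simpa using this
  exact le_of_sq_le_sq (h2.trans h) (sNorm_nonneg _)

end Scalar

/-! ### Consequences of M1 and M2 -/

section Sand

variable {ι κ μ V : Type*} [Fintype ι] [Fintype κ] [Fintype μ] [AddCommGroup V] [Module ℂ V]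

theorem sand_sand (α : Matrix ι κ ℂ) (α' : Matrix κ μ ℂ) (v : Matrix μ μ V) (β' : Matrix μ κ ℂ)
    (β : Matrix κ ι ℂ) : sand α (sand α' v β') β = sand (α * α') v (β' * β) := by
  ext i j
  simp only [sand, Matrix.of_apply, Matrix.mul_apply, Finset.smul_sum, Finset.sum_mul, Finset.mul_sum,
    Finset.sum_smul, smul_smul]
  calc _ = ∑ k, ∑ m, ∑ l, ∑ p, (α i k * β l j * (α' k m * β' p l)) • v m p := by
        refine Finset.sum_congr rfl fun k _ => ?_
        rw [Finset.sum_comm]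
    _ = ∑ m, ∑ k, ∑ p, ∑ l, (α i k * β l j * (α' k m * β' p l)) • v m p := by
        rw [Finset.sum_comm]
        refine Finset.sum_congr rfl fun m _ => Finset.sum_congr rfl fun k _ => ?_
        rw [Finset.sum_comm]
    _ = ∑ m, ∑ p, ∑ k, ∑ l, (α i k * β l j * (α' k m * β' p l)) • v m p := by
        refine Finset.sum_congr rfl fun m _ => ?_
        rw [Finset.sum_comm]
    _ = _ := by
        refine Finset.sum_congr rfl fun m _ => Finset.sum_congr rfl fun p _ => ?_
        rw [Finset.sum_comm]
        refine Finset.sum_congr rfl fun l _ => Finset.sum_congr rfl fun k _ => ?_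
        congr 1
        ring

theorem sand_map {W F : Type*} [AddCommGroup W] [Module ℂ W] [FunLike F V W]
    [LinearMapClass F ℂ V W] (f : F) (α : Matrix ι κ ℂ) (v : Matrix κ κ V) (β : Matrix κ ι ℂ) :
    (sand α v β).map f = sand α (v.map f) β := by
  ext i j
  simp [sand, map_sum]

end Sand

theorem submatrix_eq_sand {ι κ : Type} {V : Type*} [Fintype ι] [Fintype κ] [DecidableEq κ]
    [AddCommGroup V] [Module ℂ V] (f : ι → κ) (v : Matrix κ κ V) :
    v.submatrix f f = sand (pick f) v (pick f)ᵀ := by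
  ext i j
  simp [sand, pick]

/-- The axioms for matrix norms indexed by arbitrary finite types, in a minimal form. -/
structure Ruan {V : Type*} [AddCommGroup V] [Module ℂ V]
    (N : ∀ (ι : Type) [Fintype ι], Matrix ι ι V → ℝ) : Prop where
  nonneg : ∀ (ι : Type) [Fintype ι] (v : Matrix ι ι V), 0 ≤ N ι v
  blocks : ∀ (ι κ : Type) [Fintype ι] [Fintype κ] (v : Matrix ι ι V) (w : Matrix κ κ V),
    N (ι ⊕ κ) (fromBlocks v 0 0 w) ≤ max (N ι v) (N κ w)
  sand : ∀ (ι κ : Type) [Fintype ι] [Fintype κ] (α : Matrix ι κ ℂ) (v : Matrix κ κ V)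
    (β : Matrix κ ι ℂ), N ι (sand α v β) ≤ sNorm α * N κ v * sNorm β

namespace Ruan

variable {V : Type*} [AddCommGroup V] [Module ℂ V]
  {N : ∀ (ι : Type) [Fintype ι], Matrix ι ι V → ℝ}
  {ι κ : Type} [Fintype ι] [Fintype κ]

theorem submatrix_le (h : Ruan N) {f : ι → κ} (hf : Function.Injective f) (v : Matrix κ κ V) :
    N ι (v.submatrix f f) ≤ N κ v := by
  classical
  rw [submatrix_eq_sand]
  refine (h.sand _ _ _ _ _).trans ?_
  have h1 := sNorm_pick_le hf
  have h2 := sNorm_pickT_le hf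
  have := h.nonneg _ v
  have := sNorm_nonneg (pick f)
  have := sNorm_nonneg (pick f)ᵀ
  calc _ ≤ 1 * N κ v * 1 := by gcongr
    _ = _ := by ring

theorem submatrix_equiv (h : Ruan N) (e : ι ≃ κ) (v : Matrix κ κ V) : N ι (v.submatrix e e) = N κ v := by
  refine le_antisymm (h.submatrix_le e.injective v) ?_
  have := h.submatrix_le e.symm.injective (v.submatrix e e)
  simpa [Matrix.submatrix_submatrix] using this

theorem zero (h : Ruan N) : N ι 0 = 0 := by
  refine le_antisymm ?_ (h.nonneg _ _)
  have := h.sand ι ι 0 0 0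
  have e : OpSp.sand (0 : Matrix ι ι ℂ) (0 : Matrix ι ι V) 0 = 0 := by
    ext i j
    simp [OpSp.sand]
  simpa [e, sNorm_zero] using this

theorem smul_le (h : Ruan N) (c : ℂ) (v : Matrix ι ι V) : N ι (c • v) ≤ ‖c‖ * N ι v := by
  classical
  have := h.sand ι ι (c • 1) v 1
  have e : OpSp.sand (c • 1) v 1 = c • v := by
    ext i j
    simp [OpSp.sand, Matrix.one_apply]
  rw [e, sNorm_smul] at this
  refine this.trans ?_
  have h1 := sNorm_one_le (ι := ι)
  have := h.nonneg _ v
  calc _ ≤ ‖c‖ * 1 * N ι v * 1 := by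
        have := sNorm_nonneg (1 : Matrix ι ι ℂ)
        gcongr
    _ = _ := by ring

theorem smul (h : Ruan N) (c : ℂ) (v : Matrix ι ι V) : N ι (c • v) = ‖c‖ * N ι v := by
  refine le_antisymm (h.smul_le c v) ?_
  by_cases hc : c = 0
  · simp [hc, h.nonneg]
  · have := h.smul_le c⁻¹ (c • v)
    rw [smul_smul, inv_mul_cancel₀ hc, one_smul, norm_inv] at this
    have hc' : 0 < ‖c‖ := norm_pos_iff.2 hc
    calc _ ≤ ‖c‖ * (‖c‖⁻¹ * N ι (c • v)) := by gcongr
      _ = _ := by field_simp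

theorem blocks_eq (h : Ruan N) (v : Matrix ι ι V) (w : Matrix κ κ V) :
    N (ι ⊕ κ) (fromBlocks v 0 0 w) = max (N ι v) (N κ w) := by
  refine le_antisymm (h.blocks _ _ v w) (max_le ?_ ?_)
  · exact h.submatrix_le Sum.inl_injective (fromBlocks v 0 0 w)
  · exact h.submatrix_le Sum.inr_injective (fromBlocks v 0 0 w)

theorem add_le (h : Ruan N) (v w : Matrix ι ι V) : N ι (v + w) ≤ N ι v + N ι w := by
  classical
  refine le_of_forall_pos_le_add fun ε hε => ?_
  set a := N ι v + ε / 2 with ha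
  set b := N ι w + ε / 2 with hb
  have hv := h.nonneg _ v
  have hw := h.nonneg _ w
  have ha0 : 0 < a := by positivity
  have hb0 : 0 < b := by positivity
  let α : Matrix ι (ι ⊕ ι) ℂ :=
    fromCols ((Real.sqrt a : ℂ) • (1 : Matrix ι ι ℂ)) ((Real.sqrt b : ℂ) • (1 : Matrix ι ι ℂ))
  have sa : (Real.sqrt a : ℂ) * Real.sqrt a = a := by
    rw [← Complex.ofReal_mul, Real.mul_self_sqrt ha0.le]
  have sb : (Real.sqrt b : ℂ) * Real.sqrt b = b := by
    rw [← Complex.ofReal_mul, Real.mul_self_sqrt hb0.le]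
  have hα : sNorm α * sNorm α ≤ a + b := by
    rw [sNorm_sq']
    have : α * αᴴ = ((a + b : ℝ) : ℂ) • (1 : Matrix ι ι ℂ) := by
      simp only [α, conjTranspose_fromCols_eq_fromRows_conjTranspose, fromCols_mul_fromRows]
      ext i j
      by_cases hij : i = j <;>
        simp [smul_smul, Matrix.one_apply, hij, Complex.conj_ofReal, ← Complex.ofReal_mul,
          Real.mul_self_sqrt ha0.le, Real.mul_self_sqrt hb0.le]
    rw [this, sNorm_smul, Complex.norm_real, Real.norm_of_nonneg (by positivity)]
    calc _ ≤ (a + b) * 1 := by gcongr; exact sNorm_one_le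
      _ = _ := mul_one _
  have e : v + w = OpSp.sand α (fromBlocks ((a⁻¹ : ℂ) • v) 0 0 ((b⁻¹ : ℂ) • w)) αᴴ := by
    have ha' : (a : ℂ) ≠ 0 := by exact_mod_cast ha0.ne'
    have hb' : (b : ℂ) ≠ 0 := by exact_mod_cast hb0.ne'
    ext i j
    simp [OpSp.sand, α, Fintype.sum_sum_type, Matrix.one_apply, smul_smul, apply_ite, ite_smul,
      sa, sb, ha', hb', Complex.conj_ofReal]
  have hb1 : N (ι ⊕ ι) (fromBlocks ((a⁻¹ : ℂ) • v) 0 0 ((b⁻¹ : ℂ) • w)) ≤ 1 := by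
    refine (h.blocks _ _ _ _).trans (max_le ?_ ?_)
    · rw [h.smul, norm_inv, Complex.norm_real, Real.norm_of_nonneg ha0.le, inv_mul_le_one₀ ha0]
      linarith
    · rw [h.smul, norm_inv, Complex.norm_real, Real.norm_of_nonneg hb0.le, inv_mul_le_one₀ hb0]
      linarith
  calc N ι (v + w) ≤ sNorm α * N (ι ⊕ ι) (fromBlocks ((a⁻¹ : ℂ) • v) 0 0 ((b⁻¹ : ℂ) • w))
          * sNorm αᴴ := by rw [e]; exact h.sand _ _ _ _ _
    _ ≤ sNorm α * 1 * sNorm αᴴ := by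
        have := sNorm_nonneg α
        have := sNorm_nonneg αᴴ
        gcongr
    _ ≤ a + b := by rw [mul_one, sNorm_conjTranspose]; exact hα
    _ = _ := by rw [ha, hb]; ring

theorem isSeminorm (h : Ruan N) : IsOperatorSpaceSeminorm fun n => N (Fin n) where
  add_le _ v w := h.add_le v w
  smul _ c v := h.smul c v
  dsum n m v w := by
    rw [← h.blocks_eq]
    exact h.submatrix_equiv finSumFinEquiv.symm (fromBlocks v 0 0 w)
  sand _ _ α v β := h.sand _ _ α v β

end Ruan

namespace IsOperatorSpaceSeminorm

variable {V : Type*} [AddCommGroup V] [Module ℂ V] {N : ∀ n : ℕ, Matrix (Fin n) (Fin n) V → ℝ}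

theorem nonneg (h : IsOperatorSpaceSeminorm N) (n : ℕ) (v : Matrix (Fin n) (Fin n) V) : 0 ≤ N n v := by
  have h0 : N n 0 = 0 := by simpa using h.smul n 0 0
  have h1 : N n (-v) = N n v := by simpa using h.smul n (-1) v
  have := h.add_le n v (-v)
  rw [add_neg_cancel, h0, h1] at this
  linarith

theorem submatrix_le (h : IsOperatorSpaceSeminorm N) {n m : ℕ} {f : Fin m → Fin n} (hf : Function.Injective f)
    (v : Matrix (Fin n) (Fin n) V) : N m (v.submatrix f f) ≤ N n v := by
  rw [submatrix_eq_sand]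
  refine (h.sand _ _ _ _ _).trans ?_
  have h1 := sNorm_pick_le hf
  have h2 := sNorm_pickT_le hf
  have := h.nonneg _ v
  have := sNorm_nonneg (pick f)
  have := sNorm_nonneg (pick f)ᵀ
  calc _ ≤ 1 * N n v * 1 := by gcongr
    _ = _ := by ring

theorem submatrix_equiv (h : IsOperatorSpaceSeminorm N) {n m : ℕ} (e : Fin m ≃ Fin n)
    (v : Matrix (Fin n) (Fin n) V) : N m (v.submatrix e e) = N n v := by
  refine le_antisymm (h.submatrix_le e.injective v) ?_
  have := h.submatrix_le e.symm.injective (v.submatrix e e)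
  simpa [Matrix.submatrix_submatrix] using this

end IsOperatorSpaceSeminorm

namespace OperatorSpace

variable {V : Type*} [SeminormedAddCommGroup V] [NormedSpace ℂ V] [OperatorSpace V]

/-- The norm of a square matrix over an operator space, indexed by an arbitrary finite type, by
means of any enumeration of the indices (see `nrm_eq`: the choice does not matter). -/
def nrm (ι : Type) [Fintype ι] (v : Matrix ι ι V) : ℝ :=
  mnorm (Fintype.card ι) (v.submatrix (Fintype.equivFin ι).symm (Fintype.equivFin ι).symm)

theorem nrm_eq {ι : Type} [Fintype ι] {n : ℕ} (e : ι ≃ Fin n) (v : Matrix ι ι V) :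
    nrm ι v = mnorm n (v.submatrix e.symm e.symm) := by
  have := (isSeminorm (V := V)).submatrix_equiv (e.symm.trans (Fintype.equivFin ι))
    (v.submatrix (Fintype.equivFin ι).symm (Fintype.equivFin ι).symm)
  rw [nrm, ← this, submatrix_submatrix]
  congr 1
  ext i j
  simp

theorem nrm_fin {n : ℕ} (v : Matrix (Fin n) (Fin n) V) : nrm (Fin n) v = mnorm n v := by
  simpa using nrm_eq (Equiv.refl (Fin n)) v

theorem ruan : Ruan (V := V) (fun ι _ v => nrm ι v) where
  nonneg _ _ _ := isSeminorm.nonneg _ _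
  blocks ι κ _ _ v w := by
    rw [nrm_eq ((Equiv.sumCongr (Fintype.equivFin ι) (Fintype.equivFin κ)).trans finSumFinEquiv)]
    refine le_of_eq ?_
    rw [nrm, nrm, ← isSeminorm.dsum]
    congr 1
    ext i j
    obtain ⟨i, rfl⟩ := finSumFinEquiv.surjective i
    obtain ⟨j, rfl⟩ := finSumFinEquiv.surjective j
    rcases i with i | i <;> rcases j with j | j <;> simp [dsum]
  sand ι κ _ _ α v β := by
    have := (isSeminorm (V := V)).sand _ _
      (α.submatrix (Fintype.equivFin ι).symm (Fintype.equivFin κ).symm)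
      (v.submatrix (Fintype.equivFin κ).symm (Fintype.equivFin κ).symm)
      (β.submatrix (Fintype.equivFin κ).symm (Fintype.equivFin ι).symm)
    rw [sNorm_submatrix_eq, sNorm_submatrix_eq] at this
    refine le_trans (le_of_eq ?_) this
    rw [nrm]
    congr 1
    ext i j
    simp only [submatrix_apply, OpSp.sand, Matrix.of_apply]
    rw [← (Fintype.equivFin κ).symm.sum_comp]
    refine Finset.sum_congr rfl fun k _ => ?_
    rw [← (Fintype.equivFin κ).symm.sum_comp]

theorem nrm_unique {ι : Type} [Fintype ι] [Unique ι] (v : Matrix ι ι V) :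
    nrm ι v = ‖v default default‖ := by
  have := nrm_eq (Equiv.ofUnique ι (Fin 1)) v
  rw [this, mnorm_one]
  simp

theorem norm_entry_le {ι : Type} [Fintype ι] (v : Matrix ι ι V) (i j : ι) :
    ‖v i j‖ ≤ nrm ι v := by
  classical
  have h := ruan.sand (Fin 1) ι (pick fun _ => i) v (pick fun _ => j)ᵀ
  have e : OpSp.sand (pick fun _ : Fin 1 => i) v (pick fun _ => j)ᵀ = Matrix.of fun _ _ => v i j := by
    ext a b
    simp [OpSp.sand, pick]
  rw [e, nrm_fin, mnorm_one] at h
  refine h.trans ?_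
  have h1 := sNorm_pick_le (f := fun _ : Fin 1 => i) (fun _ _ _ => Subsingleton.elim _ _)
  have h2 := sNorm_pickT_le (f := fun _ : Fin 1 => j) (fun _ _ _ => Subsingleton.elim _ _)
  have := ruan.nonneg _ v
  have := sNorm_nonneg (pick fun _ : Fin 1 => i)
  have := sNorm_nonneg (pick fun _ : Fin 1 => j)ᵀ
  calc _ ≤ 1 * nrm ι v * 1 := by gcongr
    _ = _ := by ring

theorem nrm_le_sum {ι : Type} [Fintype ι] (v : Matrix ι ι V) :
    nrm ι v ≤ ∑ i, ∑ j, ‖v i j‖ := by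
  classical
  have h0 : ∀ i j : ι, nrm ι (Matrix.single i j (v i j)) ≤ ‖v i j‖ := by
    intro i j
    have h := ruan.sand ι (Fin 1) (pick fun _ => i)ᵀ (Matrix.of fun _ _ => v i j) (pick fun _ => j)
    have e : OpSp.sand (pick fun _ : Fin 1 => i)ᵀ (Matrix.of fun _ _ => v i j) (pick fun _ => j)
        = Matrix.single i j (v i j) := by
      ext a b
      by_cases ha : i = a <;> by_cases hb : j = b <;>
        simp [OpSp.sand, pick, Matrix.single, ha, hb]
    rw [e, nrm_fin, mnorm_one, Matrix.of_apply] at h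
    refine h.trans ?_
    have h1 := sNorm_pickT_le (f := fun _ : Fin 1 => i) (fun _ _ _ => Subsingleton.elim _ _)
    have h2 := sNorm_pick_le (f := fun _ : Fin 1 => j) (fun _ _ _ => Subsingleton.elim _ _)
    have := sNorm_nonneg (pick fun _ : Fin 1 => i)ᵀ
    have := sNorm_nonneg (pick fun _ : Fin 1 => j)
    calc _ ≤ 1 * ‖v i j‖ * 1 := by gcongr
      _ = _ := by ring
  have hs : ∀ {γ : Type} (s : Finset γ) (f : γ → Matrix ι ι V),
      nrm ι (∑ a ∈ s, f a) ≤ ∑ a ∈ s, nrm ι (f a) := by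
    intro γ s f
    induction s using Finset.induction_on with
    | empty => simp [ruan.zero]
    | insert a s ha ih =>
      rw [Finset.sum_insert ha, Finset.sum_insert ha]
      exact (ruan.add_le _ _).trans (by gcongr)
  conv_lhs => rw [Matrix.matrix_eq_sum_single v]
  refine (hs _ _).trans (Finset.sum_le_sum fun i _ => (hs _ _).trans ?_)
  exact Finset.sum_le_sum fun j _ => h0 i j

end OperatorSpace

theorem OperatorSpace.isOperatorSpaceNorm {V : Type*} [NormedAddCommGroup V] [NormedSpace ℂ V]
    [OperatorSpace V] : IsOperatorSpaceNorm (OperatorSpace.mnorm (V := V)) where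
  __ := OperatorSpace.isSeminorm
  eq_zero n v hv := by
    ext i j
    have := OperatorSpace.norm_entry_le v i j
    rw [OperatorSpace.nrm_fin, hv] at this
    simpa using this

/-! ### Subspaces -/

open OperatorSpace

instance instSubmodule {V : Type*} [SeminormedAddCommGroup V] [NormedSpace ℂ V] [OperatorSpace V]
    (F : Submodule ℂ V) : OperatorSpace F where
  mnorm n a := mnorm n (a.map (fun x : F => (x : V)))
  isSeminorm :=
    { add_le := fun n v w => isSeminorm.add_le n _ _
      smul := fun n c v => isSeminorm.smul n c _
      dsum := fun n m v w => by
        rw [← isSeminorm.dsum]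
        congr 1
        ext i j
        obtain ⟨i, rfl⟩ := finSumFinEquiv.surjective i
        obtain ⟨j, rfl⟩ := finSumFinEquiv.surjective j
        rcases i with i | i <;> rcases j with j | j <;> simp [dsum]
      sand := fun n m α v β => by
        have := isSeminorm.sand n m α (v.map (fun x : F => (x : V))) β
        refine le_trans (le_of_eq ?_) this
        exact congrArg _ (sand_map F.subtype α v β) }
  mnorm_one v := mnorm_one _

/-! ### The dual operator space -/

section Dual

variable {V : Type*} [SeminormedAddCommGroup V] [NormedSpace ℂ V]

/-- The scalar matrix `(f_{ij}(v_{kl}))`. -/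
def pairing {ι κ : Type} (f : Matrix ι ι (V →L[ℂ] ℂ)) (v : Matrix κ κ V) :
    Matrix (ι × κ) (ι × κ) ℂ :=
  Matrix.of fun a b => f a.1 b.1 (v a.2 b.2)

variable [OperatorSpace V]

/-- The norm of `f ∈ M_ι(V*)` as a completely bounded map from `V` to the scalar matrices. -/
def dualNorm (ι : Type) [Fintype ι] (f : Matrix ι ι (V →L[ℂ] ℂ)) : ℝ :=
  sSup {r : ℝ | ∃ (m : ℕ) (v : Matrix (Fin m) (Fin m) V), mnorm m v ≤ 1 ∧ r = sNorm (pairing f v)}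

variable {ι κ : Type} [Fintype ι] [Fintype κ]

theorem sNorm_row_le (y : ι → ℂ) :
    sNorm (Matrix.of fun (_ : Fin 1) i => y i) ≤ Real.sqrt (∑ i, ‖y i‖ ^ 2) := by
  refine sNorm_le _ (Real.sqrt_nonneg _) fun x => ?_
  rw [Real.sq_sqrt (by positivity)]
  simp only [Finset.univ_unique, Finset.sum_singleton, mulVec, dotProduct, Matrix.of_apply]
  calc _ ≤ (∑ i, ‖y i‖ * ‖x i‖) ^ 2 := by
        gcongr
        exact (norm_sum_le _ _).trans (le_of_eq (by simp))
    _ ≤ _ := Finset.sum_mul_sq_le_sq_mul_sq _ _ _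

theorem sNorm_col_le (y : ι → ℂ) :
    sNorm (Matrix.of fun i (_ : Fin 1) => y i) ≤ Real.sqrt (∑ i, ‖y i‖ ^ 2) := by
  have := sNorm_row_le (fun i => star (y i))
  rw [← sNorm_conjTranspose] at this
  simpa [conjTranspose, Matrix.map, Matrix.transpose] using this

/-- A bounded functional is completely bounded, with the same norm. -/
theorem sNorm_map_le (f : V →L[ℂ] ℂ) (v : Matrix ι ι V) : sNorm (v.map f) ≤ ‖f‖ * nrm ι v := by
  have hn := ruan.nonneg _ v
  refine sNorm_le _ (by positivity) fun x => ?_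
  set y := v.map f *ᵥ x with hy
  set Y := ∑ i, ‖y i‖ ^ 2 with hY
  set X := ∑ i, ‖x i‖ ^ 2 with hX
  have hY0 : 0 ≤ Y := by positivity
  have hX0 : 0 ≤ X := by positivity
  have key : Y ≤ ‖f‖ * nrm ι v * Real.sqrt Y * Real.sqrt X := by
    have h := ruan.sand (Fin 1) ι (Matrix.of fun (_ : Fin 1) i => star (y i)) v
      (Matrix.of fun i (_ : Fin 1) => x i)
    rw [nrm_fin, mnorm_one] at h
    have e : f (sand (Matrix.of fun (_ : Fin 1) i => star (y i)) v
        (Matrix.of fun i (_ : Fin 1) => x i) 0 0) = (Y : ℂ) := by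
      have e1 : ∀ i, y i = ∑ j, f (v i j) * x j := fun i => by simp [hy, mulVec, dotProduct]
      have e2 : (Y : ℂ) = ∑ i, star (y i) * y i := by
        rw [hY]
        push_cast
        refine Finset.sum_congr rfl fun i _ => ?_
        rw [mul_comm]
        exact (Complex.mul_conj' (y i)).symm
      rw [e2]
      simp only [sand, Matrix.of_apply, map_sum, map_smul, smul_eq_mul]
      refine Finset.sum_congr rfl fun i _ => ?_
      conv_rhs => rw [e1 i, Finset.mul_sum]
      refine Finset.sum_congr rfl fun j _ => ?_
      rw [← e1 i]
      ring
    have h1 := sNorm_row_le (fun i => star (y i))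
    have h2 := sNorm_col_le x
    simp only [norm_star] at h1
    calc Y = ‖(Y : ℂ)‖ := by rw [Complex.norm_real, Real.norm_of_nonneg hY0]
      _ ≤ ‖f‖ * ‖_‖ := by rw [← e]; exact f.le_opNorm _
      _ ≤ ‖f‖ * (Real.sqrt Y * nrm ι v * Real.sqrt X) := by
          have := sNorm_nonneg (Matrix.of fun (_ : Fin 1) i => star (y i))
          have := sNorm_nonneg (Matrix.of fun i (_ : Fin 1) => x i)
          gcongr
          refine h.trans ?_
          gcongr
      _ = _ := by ring
  have sY := Real.mul_self_sqrt hY0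
  have sX := Real.mul_self_sqrt hX0
  have nY := Real.sqrt_nonneg Y
  have nX := Real.sqrt_nonneg X
  have h3 : Real.sqrt Y ≤ ‖f‖ * nrm ι v * Real.sqrt X := by
    rcases nY.eq_or_lt with h0 | h0
    · rw [← h0]; positivity
    · refine le_of_mul_le_mul_right ?_ h0
      rw [sY]
      linarith
  calc Y = Real.sqrt Y ^ 2 := by rw [sq, sY]
    _ ≤ (‖f‖ * nrm ι v * Real.sqrt X) ^ 2 := by gcongr
    _ = _ := by rw [mul_pow _ (Real.sqrt X), sq (Real.sqrt X), sX]

theorem sNorm_sum_le {γ : Type*} (s : Finset γ) (f : γ → Matrix ι κ ℂ) :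
    sNorm (∑ a ∈ s, f a) ≤ ∑ a ∈ s, sNorm (f a) := by
  classical
  open scoped Matrix.Norms.L2Operator in exact norm_sum_le s f

theorem sNorm_pairing_le (f : Matrix ι ι (V →L[ℂ] ℂ)) (v : Matrix κ κ V) :
    sNorm (pairing f v) ≤ (∑ i, ∑ j, ‖f i j‖) * nrm κ v := by
  classical
  have e : pairing f v = ∑ i, ∑ j,
      kroneckerMap (· * ·) ((pick fun _ : Fin 1 => i)ᵀ * pick fun _ : Fin 1 => j) (v.map (f i j)) := by
    ext ⟨i, k⟩ ⟨j, l⟩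
    simp only [Matrix.sum_apply, kroneckerMap_apply, Matrix.map_apply, pairing, Matrix.of_apply]
    rw [Finset.sum_eq_single i, Finset.sum_eq_single j]
    · simp [Matrix.mul_apply, pick]
    · intro b _ hb; simp [Matrix.mul_apply, pick, hb]
    · simp
    · intro b _ hb; simp [Matrix.mul_apply, pick, hb]
    · simp
  rw [e, Finset.sum_mul]
  refine (sNorm_sum_le _ _).trans (Finset.sum_le_sum fun i _ => ?_)
  rw [Finset.sum_mul]
  refine (sNorm_sum_le _ _).trans (Finset.sum_le_sum fun j _ => ?_)
  refine (sNorm_kron_le _ _).trans ?_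
  have h1 : sNorm ((pick fun _ : Fin 1 => i)ᵀ * pick fun _ : Fin 1 => j) ≤ 1 * 1 :=
    (sNorm_mul _ _).trans (mul_le_mul (sNorm_pickT_le fun _ _ _ => Subsingleton.elim _ _)
      (sNorm_pick_le fun _ _ _ => Subsingleton.elim _ _) (sNorm_nonneg _) zero_le_one)
  calc _ ≤ (1 * 1) * (‖f i j‖ * nrm κ v) :=
        mul_le_mul h1 (sNorm_map_le _ _) (sNorm_nonneg _) (by norm_num)
    _ = _ := by ring

theorem dualNorm_bddAbove (f : Matrix ι ι (V →L[ℂ] ℂ)) :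
    BddAbove {r : ℝ | ∃ (m : ℕ) (v : Matrix (Fin m) (Fin m) V),
      mnorm m v ≤ 1 ∧ r = sNorm (pairing f v)} := by
  refine ⟨∑ i, ∑ j, ‖f i j‖, ?_⟩
  rintro r ⟨m, v, hv, rfl⟩
  refine (sNorm_pairing_le f v).trans ?_
  rw [nrm_fin]
  exact mul_le_of_le_one_right (by positivity) hv

theorem dualNorm_nonneg (f : Matrix ι ι (V →L[ℂ] ℂ)) : 0 ≤ dualNorm ι f :=
  Real.sSup_nonneg (by rintro r ⟨m, v, hv, rfl⟩; exact sNorm_nonneg _)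

theorem dualNorm_le_of (f : Matrix ι ι (V →L[ℂ] ℂ)) {C : ℝ} (hC : 0 ≤ C)
    (h : ∀ (m : ℕ) (v : Matrix (Fin m) (Fin m) V), mnorm m v ≤ 1 → sNorm (pairing f v) ≤ C) :
    dualNorm ι f ≤ C :=
  Real.sSup_le (by rintro r ⟨m, v, hv, rfl⟩; exact h m v hv) hC

theorem pairing_smul (f : Matrix ι ι (V →L[ℂ] ℂ)) (c : ℂ) (v : Matrix κ κ V) :
    pairing f (c • v) = c • pairing f v := by
  ext a b
  simp [pairing]

theorem sNorm_pairing_le_dualNorm (f : Matrix ι ι (V →L[ℂ] ℂ)) {m : ℕ}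
    (v : Matrix (Fin m) (Fin m) V) : sNorm (pairing f v) ≤ dualNorm ι f * mnorm m v := by
  have hn := isSeminorm.nonneg _ v
  rcases hn.eq_or_lt with h0 | h0
  · have := sNorm_pairing_le f v
    rw [nrm_fin, ← h0, mul_zero] at this
    rwa [← h0, mul_zero]
  · have h1 : mnorm m (((mnorm m v)⁻¹ : ℂ) • v) ≤ 1 := by
      rw [isSeminorm.smul, norm_inv, Complex.norm_real, Real.norm_of_nonneg hn,
        inv_mul_cancel₀ h0.ne']
    have h2 := le_csSup (dualNorm_bddAbove f) ⟨m, _, h1, rfl⟩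
    rw [pairing_smul, sNorm_smul, norm_inv, Complex.norm_real, Real.norm_of_nonneg hn,
      inv_mul_le_iff₀ h0] at h2
    exact h2.trans (le_of_eq (mul_comm _ _))

theorem dualNorm_ruan : Ruan (V := V →L[ℂ] ℂ) (fun ι _ f => dualNorm ι f) where
  nonneg _ _ f := dualNorm_nonneg f
  blocks ι κ _ _ f g := by
    refine dualNorm_le_of _ (le_max_of_le_left (dualNorm_nonneg _)) fun m v hv => ?_
    have e : pairing (fromBlocks f 0 0 g) v
        = (fromBlocks (pairing f v) 0 0 (pairing g v)).submatrix
          (Equiv.sumProdDistrib ι κ (Fin m)) (Equiv.sumProdDistrib ι κ (Fin m)) := by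
      ext ⟨i, k⟩ ⟨j, l⟩
      rcases i with i | i <;> rcases j with j | j <;> simp [pairing]
    rw [e, sNorm_submatrix_eq]
    refine (sNorm_fromBlocks_le _ _).trans (max_le_max ?_ ?_)
    · exact le_csSup (dualNorm_bddAbove f) ⟨m, v, hv, rfl⟩
    · exact le_csSup (dualNorm_bddAbove g) ⟨m, v, hv, rfl⟩
  sand ι κ _ _ α f β := by
    have n1 := sNorm_nonneg α
    have n2 := sNorm_nonneg β
    have n3 := dualNorm_nonneg f
    refine dualNorm_le_of _ (by positivity) fun m v hv => ?_
    have e : pairing (OpSp.sand α f β) v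
        = kroneckerMap (· * ·) α (1 : Matrix (Fin m) (Fin m) ℂ) * pairing f v *
          kroneckerMap (· * ·) β (1 : Matrix (Fin m) (Fin m) ℂ) := by
      ext ⟨i, k⟩ ⟨j, l⟩
      simp only [pairing, OpSp.sand, Matrix.of_apply, Matrix.mul_apply, Fintype.sum_prod_type,
        kroneckerMap_apply, Matrix.one_apply, mul_ite, mul_one, mul_zero, ite_mul, zero_mul,
        Finset.sum_ite_eq, Finset.sum_ite_eq', Finset.mem_univ, if_true,
        _root_.sum_apply, _root_.smul_apply, smul_eq_mul, Finset.sum_mul]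
      rw [Finset.sum_comm]
      refine Finset.sum_congr rfl fun a _ => Finset.sum_congr rfl fun b _ => ?_
      ring
    rw [e]
    have h1 := sNorm_kron_one_le (μ := Fin m) α
    have h2 := sNorm_kron_one_le (μ := Fin m) β
    have h3 := le_csSup (dualNorm_bddAbove f) ⟨m, v, hv, rfl⟩
    refine (sNorm_mul _ _).trans (mul_le_mul ?_ h2 (sNorm_nonneg _) (by positivity))
    exact (sNorm_mul _ _).trans (mul_le_mul h1 h3 (sNorm_nonneg _) n1)

instance instDual : OperatorSpace (V →L[ℂ] ℂ) where
  mnorm n f := dualNorm (Fin n) f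
  isSeminorm := dualNorm_ruan.isSeminorm
  mnorm_one f := by
    have e : ∀ (m : ℕ) (v : Matrix (Fin m) (Fin m) V), sNorm (pairing f v)
        = sNorm (v.map (f 0 0)) := by
      intro m v
      rw [← sNorm_submatrix_eq (v.map (f 0 0)) (Equiv.uniqueProd (Fin m) (Fin 1))
        (Equiv.uniqueProd (Fin m) (Fin 1))]
      congr 1
      ext ⟨i, k⟩ ⟨j, l⟩
      rw [Subsingleton.elim i 0, Subsingleton.elim j 0]
      simp [pairing]
    refine le_antisymm (dualNorm_le_of _ (norm_nonneg _) fun m v hv => ?_) ?_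
    · rw [e]
      refine (sNorm_map_le _ _).trans ?_
      rw [nrm_fin]
      exact mul_le_of_le_one_right (norm_nonneg _) hv
    · refine ContinuousLinearMap.opNorm_le_bound _ (dualNorm_nonneg f) fun x => ?_
      have h := sNorm_pairing_le_dualNorm f (Matrix.of fun (_ _ : Fin 1) => x)
      rw [e, mnorm_one, Matrix.of_apply] at h
      exact (norm_entry_le_sNorm ((Matrix.of fun (_ _ : Fin 1) => x).map (f 0 0)) 0 0).trans h

end Dual

/-! ### The completion of an operator space -/

section Completion

open UniformSpace

variable {A : Type*} [SeminormedAddCommGroup A] [NormedSpace ℂ A] [OperatorSpace A]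
  {ι κ : Type} [Fintype ι] [Fintype κ]

/-- The canonical map `M_ι(A) → M_ι(Â)`. -/
def coeM (a : Matrix ι ι A) : Matrix ι ι (Completion A) := a.map (fun x => (x : Completion A))

theorem coeM_isUniformInducing : IsUniformInducing (coeM : Matrix ι ι A → _) :=
  (Isometry.piMap (fun (_ : ι) => Pi.map fun (_ : ι) => ((↑) : A → Completion A))
    (fun _ => Isometry.piMap _ fun _ => Completion.coe_isometry)).isUniformInducing

theorem coeM_denseRange : DenseRange (coeM : Matrix ι ι A → _) :=
  DenseRange.piMap (f := fun (_ : ι) => Pi.map fun (_ : ι) => ((↑) : A → Completion A))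
    (fun _ => DenseRange.piMap fun _ => Completion.denseRange_coe)

theorem nrm_uniformContinuous : UniformContinuous (nrm ι : Matrix ι ι A → ℝ) := by
  have ht : ∀ u v : Matrix ι ι A, nrm ι u ≤ nrm ι (u - v) + nrm ι v := by
    intro u v
    simpa using ruan.add_le (u - v) v
  have hd : ∀ u v : ι → ι → A, nrm ι (u : Matrix ι ι A) - nrm ι (v : Matrix ι ι A)
      ≤ (Fintype.card ι * Fintype.card ι : ℝ) * dist u v := by
    intro u v
    have h1 : nrm ι (u : Matrix ι ι A) ≤ nrm ι ((u : Matrix ι ι A) - v) + nrm ι (v : Matrix ι ι A) := by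
      exact ht u v
    have h2 : nrm ι ((u : Matrix ι ι A) - v) ≤ ∑ _i : ι, ∑ _j : ι, dist u v := by
      refine (nrm_le_sum _).trans (Finset.sum_le_sum fun i _ => Finset.sum_le_sum fun j _ => ?_)
      have h3 : ‖u i j - v i j‖ = dist (u i j) (v i j) := (dist_eq_norm _ _).symm
      exact h3.le.trans ((dist_le_pi_dist (u i) (v i) j).trans (dist_le_pi_dist u v i))
    simp only [Finset.sum_const, Finset.card_univ, nsmul_eq_mul] at h2
    rw [← mul_assoc] at h2
    linarith
  have hL : LipschitzWith (Fintype.card ι * Fintype.card ι : NNReal)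
      (fun u : ι → ι → A => nrm ι (u : Matrix ι ι A)) := by
    refine LipschitzWith.of_dist_le_mul fun u v => ?_
    rw [Real.dist_eq, abs_le]
    have h1 := hd u v
    have h2 := hd v u
    rw [dist_comm] at h2
    push_cast
    constructor <;> linarith
  exact hL.uniformContinuous

/-- The matrix norms on the completion: the continuous extensions of those of `A`. -/
def complNorm (ι : Type) [Fintype ι] : Matrix ι ι (Completion A) → ℝ :=
  (coeM_isUniformInducing.isDenseInducing coeM_denseRange).extend (nrm ι : Matrix ι ι A → ℝ)

theorem complNorm_coe (a : Matrix ι ι A) : complNorm ι (coeM a) = nrm ι a :=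
  uniformly_extend_of_ind coeM_isUniformInducing coeM_denseRange nrm_uniformContinuous a

theorem complNorm_continuous : Continuous (complNorm ι : Matrix ι ι (Completion A) → ℝ) :=
  (uniformContinuous_uniformly_extend coeM_isUniformInducing coeM_denseRange
    nrm_uniformContinuous).continuous

theorem continuous_sand {W : Type*} [SeminormedAddCommGroup W] [NormedSpace ℂ W]
    (α : Matrix ι κ ℂ) (β : Matrix κ ι ℂ) : Continuous fun v : Matrix κ κ W => sand α v β := by
  refine continuous_matrix fun i j => ?_
  simp only [sand, Matrix.of_apply]
  refine continuous_finsetSum _ fun k _ => continuous_finsetSum _ fun l _ => ?_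
  exact (continuous_id.matrix_elem k l).const_smul _

theorem complNorm_ruan : Ruan (V := Completion A) (fun ι _ u => complNorm ι u) where
  nonneg ι _ u := by
    refine coeM_denseRange.induction_on (p := fun u => 0 ≤ complNorm ι u) u
      (isClosed_le continuous_const complNorm_continuous) fun a => ?_
    rw [complNorm_coe]
    exact ruan.nonneg _ a
  blocks ι κ _ _ u v := by
    refine (coeM_denseRange.prodMap coeM_denseRange).induction_on
      (p := fun x : Matrix ι ι (Completion A) × Matrix κ κ (Completion A) =>
        complNorm (ι ⊕ κ) (fromBlocks x.1 0 0 x.2) ≤ max (complNorm ι x.1) (complNorm κ x.2))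
      (u, v) ?_ ?_
    · refine isClosed_le (complNorm_continuous.comp ?_) ?_
      · exact Continuous.matrix_fromBlocks continuous_fst continuous_const continuous_const
          continuous_snd
      · exact (complNorm_continuous.comp continuous_fst).max
          (complNorm_continuous.comp continuous_snd)
    · rintro ⟨a, b⟩
      have e : fromBlocks (coeM a) 0 0 (coeM b) = coeM (fromBlocks a 0 0 b) := by
        ext i j
        rcases i with i | i <;> rcases j with j | j <;> simp [coeM, Completion.coe_zero]
      simp only [Prod.map_apply]
      rw [e, complNorm_coe, complNorm_coe, complNorm_coe]
      exact ruan.blocks _ _ a b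
  sand ι κ _ _ α u β := by
    refine coeM_denseRange.induction_on
      (p := fun u => complNorm ι (OpSp.sand α u β) ≤ sNorm α * complNorm κ u * sNorm β) u ?_ ?_
    · refine isClosed_le (complNorm_continuous.comp (continuous_sand α β)) ?_
      exact (continuous_const.mul complNorm_continuous).mul continuous_const
    · intro a
      have e : OpSp.sand α (coeM a) β = coeM (OpSp.sand α a β) :=
        (sand_map (Completion.toComplL (𝕜 := ℂ) (E := A)) α a β).symm
      rw [e, complNorm_coe, complNorm_coe]
      exact ruan.sand _ _ α a β

instance instCompletion : OperatorSpace (Completion A) where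
  mnorm n u := complNorm (Fin n) u
  isSeminorm := complNorm_ruan.isSeminorm
  mnorm_one u := by
    refine coeM_denseRange.induction_on (p := fun u => complNorm (Fin 1) u = ‖u 0 0‖) u ?_ ?_
    · exact isClosed_eq complNorm_continuous (continuous_id.matrix_elem 0 0).norm
    · intro a
      rw [complNorm_coe, nrm_fin, mnorm_one]
      exact (Completion.norm_coe _).symm

end Completion

/-! ### The operator space projective tensor product -/

open scoped TensorProduct

section Proj

variable {V W : Type*} [SeminormedAddCommGroup V] [NormedSpace ℂ V] [OperatorSpace V]
  [SeminormedAddCommGroup W] [NormedSpace ℂ W] [OperatorSpace W]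

/-- The matrix `v ⊗ w = (v_{ij} ⊗ w_{kl})`, with rows indexed by `(i,k)` and columns by `(j,l)`. -/
def kron {V W : Type*} [AddCommGroup V] [Module ℂ V] [AddCommGroup W] [Module ℂ W]
    {ι κ : Type} (v : Matrix ι ι V) (w : Matrix κ κ W) :
    Matrix (ι × κ) (ι × κ) (V ⊗[ℂ] W) :=
  Matrix.of fun a b => v a.1 b.1 ⊗ₜ[ℂ] w a.2 b.2

/-- The operator space projective tensor norm on matrices over the algebraic tensor product: the
infimum of `‖α‖ ‖v‖ ‖w‖ ‖β‖` over all the representations `u = α (v ⊗ w) β`. -/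
def projNorm (ι : Type) [Fintype ι] (u : Matrix ι ι (V ⊗[ℂ] W)) : ℝ :=
  sInf {r : ℝ | ∃ (p q : ℕ) (α : Matrix ι (Fin p × Fin q) ℂ) (v : Matrix (Fin p) (Fin p) V)
    (w : Matrix (Fin q) (Fin q) W) (β : Matrix (Fin p × Fin q) ι ℂ),
    u = sand α (kron v w) β ∧ r = sNorm α * mnorm p v * mnorm q w * sNorm β}

variable {ι κ : Type} [Fintype ι] [Fintype κ]

theorem projNorm_bddBelow (u : Matrix ι ι (V ⊗[ℂ] W)) :
    BddBelow {r : ℝ | ∃ (p q : ℕ) (α : Matrix ι (Fin p × Fin q) ℂ) (v : Matrix (Fin p) (Fin p) V)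
    (w : Matrix (Fin q) (Fin q) W) (β : Matrix (Fin p × Fin q) ι ℂ),
    u = sand α (kron v w) β ∧ r = sNorm α * mnorm p v * mnorm q w * sNorm β} := by
  refine ⟨0, ?_⟩
  rintro r ⟨p, q, α, v, w, β, -, rfl⟩
  have := sNorm_nonneg α
  have := sNorm_nonneg β
  have := isSeminorm.nonneg _ v
  have := isSeminorm.nonneg _ w
  positivity

theorem projNorm_nonneg (u : Matrix ι ι (V ⊗[ℂ] W)) : 0 ≤ projNorm ι u := by
  refine Real.sInf_nonneg ?_
  rintro r ⟨p, q, α, v, w, β, -, rfl⟩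
  have := sNorm_nonneg α
  have := sNorm_nonneg β
  have := isSeminorm.nonneg _ v
  have := isSeminorm.nonneg _ w
  positivity

/-- Representations indexed by arbitrary finite types may be used. -/
theorem exists_rep {γ δ : Type} [Fintype γ] [Fintype δ] (α : Matrix ι (γ × δ) ℂ)
    (v : Matrix γ γ V) (w : Matrix δ δ W) (β : Matrix (γ × δ) ι ℂ) :
    ∃ (p q : ℕ) (α' : Matrix ι (Fin p × Fin q) ℂ) (v' : Matrix (Fin p) (Fin p) V)
      (w' : Matrix (Fin q) (Fin q) W) (β' : Matrix (Fin p × Fin q) ι ℂ),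
      sand α (kron v w) β = sand α' (kron v' w') β' ∧
      sNorm α * nrm γ v * nrm δ w * sNorm β
        = sNorm α' * mnorm p v' * mnorm q w' * sNorm β' := by
  let e := Fintype.equivFin γ
  let f := Fintype.equivFin δ
  let g := (Equiv.prodCongr e f).symm
  refine ⟨_, _, α.submatrix (Equiv.refl ι) g, v.submatrix e.symm e.symm,
    w.submatrix f.symm f.symm, β.submatrix g (Equiv.refl ι), ?_, ?_⟩
  · ext i j
    simp only [sand, Matrix.of_apply]
    rw [← g.sum_comp]
    refine Finset.sum_congr rfl fun a _ => ?_
    rw [← g.sum_comp]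
    rfl
  · rw [sNorm_submatrix_eq, sNorm_submatrix_eq]
    rfl

theorem projNorm_le {γ δ : Type} [Fintype γ] [Fintype δ] (α : Matrix ι (γ × δ) ℂ)
    (v : Matrix γ γ V) (w : Matrix δ δ W) (β : Matrix (γ × δ) ι ℂ) :
    projNorm ι (sand α (kron v w) β) ≤ sNorm α * nrm γ v * nrm δ w * sNorm β := by
  obtain ⟨p, q, α', v', w', β', h1, h2⟩ := exists_rep α v w β
  rw [h1, h2]
  exact csInf_le (projNorm_bddBelow _) ⟨p, q, α', v', w', β', rfl, rfl⟩

theorem sand_fromBlocks {V : Type*} [AddCommGroup V] [Module ℂ V] {ι κ ι' κ' : Type}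
    [Fintype κ] [Fintype κ'] (α : Matrix ι κ ℂ) (v : Matrix κ κ V)
    (β : Matrix κ ι ℂ) (α' : Matrix ι' κ' ℂ) (v' : Matrix κ' κ' V) (β' : Matrix κ' ι' ℂ) :
    sand (fromBlocks α 0 0 α') (fromBlocks v 0 0 v') (fromBlocks β 0 0 β')
      = fromBlocks (sand α v β) 0 0 (sand α' v' β') := by
  ext i j
  rcases i with i | i <;> rcases j with j | j <;> simp [sand]

/-- The inclusion of the diagonal blocks. -/
def diagIncl (γ δ γ' δ' : Type) : (γ × δ) ⊕ (γ' × δ') → (γ ⊕ γ') × (δ ⊕ δ') :=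
  Sum.elim (Prod.map Sum.inl Sum.inl) (Prod.map Sum.inr Sum.inr)

theorem diagIncl_injective (γ δ γ' δ' : Type) : Function.Injective (diagIncl γ δ γ' δ') := by
  rintro (⟨a, b⟩ | ⟨a, b⟩) (⟨c, d⟩ | ⟨c, d⟩) h <;> simp_all [diagIncl]

theorem kron_submatrix {V W : Type*} [AddCommGroup V] [Module ℂ V] [AddCommGroup W] [Module ℂ W]
    {γ δ γ' δ' : Type} (v : Matrix γ γ V) (w : Matrix δ δ W)
    (v' : Matrix γ' γ' V) (w' : Matrix δ' δ' W) :
    (kron (fromBlocks v 0 0 v') (fromBlocks w 0 0 w')).submatrix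
      (diagIncl γ δ γ' δ') (diagIncl γ δ γ' δ') = fromBlocks (kron v w) 0 0 (kron v' w') := by
  ext i j
  rcases i with i | i <;> rcases j with j | j <;> simp [kron, diagIncl]

theorem rep_blocks {γ δ γ' δ' : Type} [Fintype γ] [Fintype δ] [Fintype γ'] [Fintype δ']
    (α : Matrix ι (γ × δ) ℂ) (v : Matrix γ γ V) (w : Matrix δ δ W) (β : Matrix (γ × δ) ι ℂ)
    (α' : Matrix κ (γ' × δ') ℂ) (v' : Matrix γ' γ' V) (w' : Matrix δ' δ' W)
    (β' : Matrix (γ' × δ') κ ℂ) :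
    ∃ (a : Matrix (ι ⊕ κ) ((γ ⊕ γ') × (δ ⊕ δ')) ℂ) (b : Matrix ((γ ⊕ γ') × (δ ⊕ δ')) (ι ⊕ κ) ℂ),
      fromBlocks (sand α (kron v w) β) 0 0 (sand α' (kron v' w') β')
        = sand a (kron (fromBlocks v 0 0 v') (fromBlocks w 0 0 w')) b ∧
      sNorm a ≤ max (sNorm α) (sNorm α') ∧ sNorm b ≤ max (sNorm β) (sNorm β') := by
  classical
  refine ⟨fromBlocks α 0 0 α' * pick (diagIncl γ δ γ' δ'),
    (pick (diagIncl γ δ γ' δ'))ᵀ * fromBlocks β 0 0 β', ?_, ?_, ?_⟩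
  · rw [← sand_sand, ← submatrix_eq_sand, kron_submatrix, sand_fromBlocks]
  · refine (sNorm_mul _ _).trans ?_
    refine (mul_le_mul (sNorm_fromBlocks_le α α') (sNorm_pick_le (diagIncl_injective γ δ γ' δ'))
      (sNorm_nonneg _) (le_max_of_le_left (sNorm_nonneg _))).trans ?_
    rw [mul_one]
  · refine (sNorm_mul _ _).trans ?_
    refine (mul_le_mul (sNorm_pickT_le (diagIncl_injective γ δ γ' δ')) (sNorm_fromBlocks_le β β')
      (sNorm_nonneg _) zero_le_one).trans ?_
    rw [one_mul]

/-- Every matrix over the algebraic tensor product is of the form `α (v ⊗ w) β`. -/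
theorem exists_eq_sand (u : Matrix ι ι (V ⊗[ℂ] W)) :
    ∃ (p q : ℕ) (α : Matrix ι (Fin p × Fin q) ℂ) (v : Matrix (Fin p) (Fin p) V)
      (w : Matrix (Fin q) (Fin q) W) (β : Matrix (Fin p × Fin q) ι ℂ),
      u = sand α (kron v w) β := by
  classical
  let P : Matrix ι ι (V ⊗[ℂ] W) → Prop := fun u => ∃ (p q : ℕ) (α : Matrix ι (Fin p × Fin q) ℂ)
    (v : Matrix (Fin p) (Fin p) V) (w : Matrix (Fin q) (Fin q) W) (β : Matrix (Fin p × Fin q) ι ℂ),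
      u = sand α (kron v w) β
  have of_rep : ∀ {γ δ : Type} [Fintype γ] [Fintype δ] (α : Matrix ι (γ × δ) ℂ)
      (v : Matrix γ γ V) (w : Matrix δ δ W) (β : Matrix (γ × δ) ι ℂ),
      P (sand α (kron v w) β) := by
    intro γ δ _ _ α v w β
    obtain ⟨p, q, α', v', w', β', h1, -⟩ := exists_rep α v w β
    exact ⟨p, q, α', v', w', β', h1⟩
  have add : ∀ u u', P u → P u' → P (u + u') := by
    rintro _ _ ⟨p, q, α, v, w, β, rfl⟩ ⟨p', q', α', v', w', β', rfl⟩
    obtain ⟨a, b, hab, -, -⟩ := rep_blocks α v w β α' v' w' β'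
    have e : sand α (kron v w) β + sand α' (kron v' w') β'
        = sand (fromCols 1 1 : Matrix ι (ι ⊕ ι) ℂ)
          (fromBlocks (sand α (kron v w) β) 0 0 (sand α' (kron v' w') β'))
          (fromRows 1 1 : Matrix (ι ⊕ ι) ι ℂ) := by
      generalize sand α (kron v w) β = x
      generalize sand α' (kron v' w') β' = y
      ext i j
      simp [sand, Matrix.one_apply]
    rw [e, hab, sand_sand]
    exact of_rep _ _ _ _
  have zero : P 0 := by
    refine ⟨0, 0, 0, 0, 0, 0, ?_⟩
    ext i j
    simp [sand]
  have single : ∀ (i j : ι) (t : V ⊗[ℂ] W), P (Matrix.single i j t) := by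
    intro i j t
    induction t using TensorProduct.induction_on with
    | zero => simpa using zero
    | add x y hx hy => rw [Matrix.single_add]; exact add _ _ hx hy
    | tmul x y =>
      have e : Matrix.single i j (x ⊗ₜ[ℂ] y) = sand (pick fun _ : Fin 1 × Fin 1 => i)ᵀ
          (kron (Matrix.of fun _ _ => x) (Matrix.of fun _ _ => y))
          (pick fun _ : Fin 1 × Fin 1 => j) := by
        ext a b
        by_cases ha : i = a <;> by_cases hb : j = b <;>
          simp [sand, pick, Matrix.single, ha, hb, kron, Fintype.sum_prod_type]
      rw [e]
      exact of_rep _ _ _ _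
  rw [Matrix.matrix_eq_sum_single u]
  refine Finset.sum_induction _ P add zero fun i _ => ?_
  exact Finset.sum_induction _ P add zero fun j _ => single i j _

/-- Normalised representations. -/
theorem exists_rep_of_lt {u : Matrix ι ι (V ⊗[ℂ] W)} {c : ℝ} (h : projNorm ι u < c) :
    ∃ (p q : ℕ) (α : Matrix ι (Fin p × Fin q) ℂ) (v : Matrix (Fin p) (Fin p) V)
      (w : Matrix (Fin q) (Fin q) W) (β : Matrix (Fin p × Fin q) ι ℂ),
      u = sand α (kron v w) β ∧ mnorm p v ≤ 1 ∧ mnorm q w ≤ 1 ∧ sNorm α ≤ Real.sqrt c ∧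
        sNorm β ≤ Real.sqrt c := by
  obtain ⟨r, ⟨p, q, α, v, w, β, hu, rfl⟩, hr⟩ := exists_lt_of_csInf_lt (by
    obtain ⟨p, q, α, v, w, β, hu⟩ := exists_eq_sand u
    exact ⟨_, p, q, α, v, w, β, hu, rfl⟩) h
  have na := sNorm_nonneg α
  have nb := sNorm_nonneg β
  have nv := isSeminorm.nonneg _ v
  have nw := isSeminorm.nonneg _ w
  have hcont : Filter.Tendsto (fun ε : ℝ => (sNorm α + ε) * (mnorm p v + ε) * (mnorm q w + ε)
      * (sNorm β + ε)) (nhdsWithin 0 (Set.Ioi 0))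
      (nhds ((sNorm α + 0) * (mnorm p v + 0) * (mnorm q w + 0) * (sNorm β + 0))) := by
    refine Filter.Tendsto.mono_left ?_ nhdsWithin_le_nhds
    exact Continuous.tendsto (by fun_prop) 0
  simp only [add_zero] at hcont
  obtain ⟨ε, hε, hε0⟩ := ((hcont.eventually_lt_const hr).and self_mem_nhdsWithin).exists
  have hε0 : 0 < ε := hε0
  set a := sNorm α + ε with ha
  set s := mnorm p v + ε with hs
  set t := mnorm q w + ε with ht
  set b := sNorm β + ε with hb
  have pa : 0 < a := by positivity
  have ps : 0 < s := by positivity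
  have pt : 0 < t := by positivity
  have pb : 0 < b := by positivity
  set k := Real.sqrt (a * s * t * b) with hk
  have pk : 0 < k := Real.sqrt_pos.2 (by positivity)
  have kk : k * k = a * s * t * b := Real.mul_self_sqrt (by positivity)
  have kc : k ≤ Real.sqrt c := Real.sqrt_le_sqrt hε.le
  refine ⟨p, q, ((k / a : ℝ) : ℂ) • α, ((s⁻¹ : ℝ) : ℂ) • v, ((t⁻¹ : ℝ) : ℂ) • w,
    ((k / b : ℝ) : ℂ) • β, ?_, ?_, ?_, ?_, ?_⟩
  · rw [hu]
    ext i j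
    simp only [sand, kron, Matrix.of_apply, Matrix.smul_apply, ← TensorProduct.smul_tmul',
      TensorProduct.tmul_smul, smul_smul, smul_eq_mul]
    refine Finset.sum_congr rfl fun x _ => Finset.sum_congr rfl fun y _ => ?_
    congr 1
    have : ((k / a : ℝ) : ℂ) * ((k / b : ℝ) : ℂ) * (((t⁻¹ : ℝ) : ℂ) * ((s⁻¹ : ℝ) : ℂ)) = 1 := by
      rw [← Complex.ofReal_mul, ← Complex.ofReal_mul, ← Complex.ofReal_mul, Complex.ofReal_eq_one]
      field_simp
      rw [sq, kk]
      ring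
    linear_combination (-(α i x * β y j)) * this
  · rw [isSeminorm.smul, Complex.norm_real, Real.norm_of_nonneg (by positivity),
      inv_mul_le_one₀ ps]
    linarith
  · rw [isSeminorm.smul, Complex.norm_real, Real.norm_of_nonneg (by positivity),
      inv_mul_le_one₀ pt]
    linarith
  · rw [sNorm_smul, Complex.norm_real, Real.norm_of_nonneg (by positivity)]
    refine le_trans ?_ kc
    rw [div_mul_eq_mul_div, div_le_iff₀ pa]
    exact mul_le_mul_of_nonneg_left (by linarith) pk.le
  · rw [sNorm_smul, Complex.norm_real, Real.norm_of_nonneg (by positivity)]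
    refine le_trans ?_ kc
    rw [div_mul_eq_mul_div, div_le_iff₀ pb]
    exact mul_le_mul_of_nonneg_left (by linarith) pk.le

theorem projNorm_ruan : Ruan (V := V ⊗[ℂ] W) (fun ι _ u => projNorm ι u) where
  nonneg _ _ u := projNorm_nonneg u
  blocks ι κ _ _ u u' := by
    refine le_of_forall_gt_imp_ge_of_dense fun c hc => ?_
    have hc0 : 0 ≤ c := (le_max_of_le_left (projNorm_nonneg u)).trans hc.le
    obtain ⟨p, q, α, v, w, β, rfl, hv, hw, hα, hβ⟩ :=
      exists_rep_of_lt ((le_max_left _ _).trans_lt hc)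
    obtain ⟨p', q', α', v', w', β', rfl, hv', hw', hα', hβ'⟩ :=
      exists_rep_of_lt ((le_max_right _ _).trans_lt hc)
    obtain ⟨a, b, hab, ha, hb⟩ := rep_blocks α v w β α' v' w' β'
    rw [hab]
    refine (projNorm_le _ _ _ _).trans ?_
    have h1 : nrm _ (fromBlocks v 0 0 v') ≤ 1 :=
      (ruan.blocks _ _ v v').trans (max_le (by rwa [nrm_fin]) (by rwa [nrm_fin]))
    have h2 : nrm _ (fromBlocks w 0 0 w') ≤ 1 :=
      (ruan.blocks _ _ w w').trans (max_le (by rwa [nrm_fin]) (by rwa [nrm_fin]))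
    have h3 := ha.trans (max_le hα hα')
    have h4 := hb.trans (max_le hβ hβ')
    have n1 := sNorm_nonneg a
    have n2 := sNorm_nonneg b
    have n3 := ruan.nonneg _ (fromBlocks v 0 0 v')
    have n4 := ruan.nonneg _ (fromBlocks w 0 0 w')
    calc _ ≤ Real.sqrt c * 1 * 1 * Real.sqrt c := by gcongr
      _ = c := by rw [mul_one, mul_one, Real.mul_self_sqrt hc0]
  sand ι κ _ _ α u β := by
    have na := sNorm_nonneg α
    have nb := sNorm_nonneg β
    have hlim : ∀ c, projNorm κ u < c → projNorm ι (OpSp.sand α u β) ≤ sNorm α * c * sNorm β := by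
      intro c hc
      have hc0 : 0 ≤ c := (projNorm_nonneg u).trans hc.le
      obtain ⟨p, q, a, v, w, b, rfl, hv, hw, ha, hb⟩ := exists_rep_of_lt hc
      rw [sand_sand]
      refine (projNorm_le _ _ _ _).trans ?_
      rw [nrm_fin, nrm_fin]
      have n1 := sNorm_nonneg a
      have n2 := sNorm_nonneg b
      have n3 := isSeminorm.nonneg _ v
      have n4 := isSeminorm.nonneg _ w
      calc _ ≤ (sNorm α * sNorm a) * mnorm p v * mnorm q w * (sNorm b * sNorm β) := by
            have h5 := sNorm_mul α a
            have h6 := sNorm_mul b β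
            have n5 := sNorm_nonneg (b * β)
            gcongr
        _ ≤ (sNorm α * Real.sqrt c) * 1 * 1 * (Real.sqrt c * sNorm β) := by gcongr
        _ = sNorm α * (Real.sqrt c * Real.sqrt c) * sNorm β := by ring
        _ = _ := by rw [Real.mul_self_sqrt hc0]
    have hcont : Filter.Tendsto (fun c : ℝ => sNorm α * c * sNorm β)
        (nhdsWithin (projNorm κ u) (Set.Ioi (projNorm κ u)))
        (nhds (sNorm α * projNorm κ u * sNorm β)) :=
      (Continuous.tendsto (by fun_prop) _).mono_left nhdsWithin_le_nhds
    exact ge_of_tendsto hcont (by filter_upwards [self_mem_nhdsWithin] with c hc using hlim c hc)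

end Proj

/-- The algebraic tensor product `V ⊗ W`, equipped with the projective matrix norms. -/
def ProjTensor (V W : Type*) [SeminormedAddCommGroup V] [NormedSpace ℂ V]
    [SeminormedAddCommGroup W] [NormedSpace ℂ W] : Type _ := V ⊗[ℂ] W

section ProjTensor

variable (V W : Type*) [SeminormedAddCommGroup V] [NormedSpace ℂ V] [OperatorSpace V]
  [SeminormedAddCommGroup W] [NormedSpace ℂ W] [OperatorSpace W]

instance : SeminormedAddCommGroup (ProjTensor V W) :=
  AddGroupSeminorm.toSeminormedAddCommGroup (E := V ⊗[ℂ] W)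
    { toFun := fun u => projNorm (Fin 1) (Matrix.of fun _ _ => u)
      map_zero' := projNorm_ruan.zero
      add_le' := fun u v => projNorm_ruan.add_le (Matrix.of fun _ _ => u) (Matrix.of fun _ _ => v)
      neg' := fun u => by
        have := projNorm_ruan.smul (-1 : ℂ) (Matrix.of fun (_ _ : Fin 1) => u)
        simpa [Matrix.smul_of, Pi.smul_def, Pi.neg_def] using this }

instance : Module ℂ (ProjTensor V W) := inferInstanceAs (Module ℂ (V ⊗[ℂ] W))

instance : NormedSpace ℂ (ProjTensor V W) where
  norm_smul_le c u := projNorm_ruan.smul_le c (Matrix.of fun (_ _ : Fin 1) => (u : V ⊗[ℂ] W))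

instance instProjTensor : OperatorSpace (ProjTensor V W) where
  mnorm n u := projNorm (V := V) (W := W) (Fin n) u
  isSeminorm := (projNorm_ruan (V := V) (W := W)).isSeminorm
  mnorm_one u := by
    refine congrArg (projNorm (V := V) (W := W) (Fin 1)) ?_
    ext i j
    rw [Subsingleton.elim i 0, Subsingleton.elim j 0]
    rfl

/-- The operator space projective tensor product: the completion of `V ⊗ W`. -/
abbrev ProjCompl : Type _ := UniformSpace.Completion (ProjTensor V W)

end ProjTensor

/-! ### Completely bounded and jointly completely bounded maps -/

section Maps

variable {V W X : Type*} [NormedAddCommGroup V] [NormedSpace ℂ V] [OperatorSpace V]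
  [NormedAddCommGroup W] [NormedSpace ℂ W] [OperatorSpace W]
  [NormedAddCommGroup X] [NormedSpace ℂ X] [OperatorSpace X]

/-- The completely bounded norm of a linear map, `∞` if the map is not completely bounded. -/
def cbNorm (r : V →L[ℂ] W) : ENNReal :=
  ⨆ (m : ℕ) (v : Matrix (Fin m) (Fin m) V) (_ : mnorm m v ≤ 1), ENNReal.ofReal (mnorm m (v.map r))

/-- For `Φ ∈ M_n(L(V × W, X))`, the matrix `Φ_m(v, w) = (Φ_{pq}(v_{ij}, w_{kl}))`, with rows
indexed by `((i,k),p)` and columns by `((j,l),q)`. -/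
def ampl {n m : ℕ} (Φ : Matrix (Fin n) (Fin n) (V →L[ℂ] W →L[ℂ] X)) (v : Matrix (Fin m) (Fin m) V)
    (w : Matrix (Fin m) (Fin m) W) :
    Matrix ((Fin m × Fin m) × Fin n) ((Fin m × Fin m) × Fin n) X :=
  Matrix.of fun a b => Φ a.2 b.2 (v a.1.1 b.1.1) (w a.1.2 b.1.2)

/-- The norm of a matrix of bilinear maps, viewed as a jointly completely bounded map into
`M_n(X)`; it is `∞` if that map is not jointly completely bounded.  (The first level of the
definition bounds the norm of a bilinear map, so nothing is lost by considering only continuous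
bilinear maps.) -/
def jcbNorm {n : ℕ} (Φ : Matrix (Fin n) (Fin n) (V →L[ℂ] W →L[ℂ] X)) : ENNReal :=
  ⨆ (m : ℕ) (v : Matrix (Fin m) (Fin m) V) (w : Matrix (Fin m) (Fin m) W)
    (_ : mnorm m v ≤ 1) (_ : mnorm m w ≤ 1), ENNReal.ofReal (nrm _ (ampl Φ v w))

theorem jcbNorm_add_le {n : ℕ} (Φ Φ' : Matrix (Fin n) (Fin n) (V →L[ℂ] W →L[ℂ] X)) :
    jcbNorm (Φ + Φ') ≤ jcbNorm Φ + jcbNorm Φ' := by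
  refine iSup_le fun m => iSup_le fun v => iSup_le fun w => iSup_le fun hv => iSup_le fun hw => ?_
  have e : ampl (Φ + Φ') v w = ampl Φ v w + ampl Φ' v w := rfl
  rw [e]
  refine (ENNReal.ofReal_le_ofReal (ruan.add_le _ _)).trans ?_
  refine ENNReal.ofReal_add_le.trans (add_le_add ?_ ?_)
  · exact le_iSup_of_le m (le_iSup_of_le v (le_iSup_of_le w (le_iSup_of_le hv
      (le_iSup_of_le hw le_rfl))))
  · exact le_iSup_of_le m (le_iSup_of_le v (le_iSup_of_le w (le_iSup_of_le hv
      (le_iSup_of_le hw le_rfl))))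

theorem jcbNorm_smul_le {n : ℕ} (c : ℂ) (Φ : Matrix (Fin n) (Fin n) (V →L[ℂ] W →L[ℂ] X)) :
    jcbNorm (c • Φ) ≤ ENNReal.ofReal ‖c‖ * jcbNorm Φ := by
  refine iSup_le fun m => iSup_le fun v => iSup_le fun w => iSup_le fun hv => iSup_le fun hw => ?_
  have e : ampl (c • Φ) v w = c • ampl Φ v w := rfl
  rw [e]
  refine (ENNReal.ofReal_le_ofReal (ruan.smul_le _ _)).trans ?_
  rw [ENNReal.ofReal_mul (norm_nonneg _)]
  gcongr
  exact le_iSup_of_le m (le_iSup_of_le v (le_iSup_of_le w (le_iSup_of_le hv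
      (le_iSup_of_le hw le_rfl))))

theorem jcbNorm_zero {n : ℕ} : jcbNorm (0 : Matrix (Fin n) (Fin n) (V →L[ℂ] W →L[ℂ] X)) = 0 := by
  have h := jcbNorm_smul_le 0 (0 : Matrix (Fin n) (Fin n) (V →L[ℂ] W →L[ℂ] X))
  have e : (0 : ℂ) • (0 : Matrix (Fin n) (Fin n) (V →L[ℂ] W →L[ℂ] X)) = 0 := by ext; simp
  rw [e, norm_zero, ENNReal.ofReal_zero, zero_mul] at h
  exact nonpos_iff_eq_zero.mp h

/-- A bilinear map as a `1 × 1` matrix. -/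
def oneMat {T : Type*} (φ : T) : Matrix (Fin 1) (Fin 1) T := Matrix.of fun _ _ => φ

variable (V W X) in
/-- The space `JCB(V × W, X)` of jointly completely bounded bilinear maps. -/
def JCB : Submodule ℂ (V →L[ℂ] W →L[ℂ] X) where
  carrier := {φ | jcbNorm (oneMat φ) < ⊤}
  zero_mem' := by
    have e : oneMat (0 : V →L[ℂ] W →L[ℂ] X) = 0 := rfl
    simp [e, jcbNorm_zero]
  add_mem' := fun {φ ψ} hφ hψ =>
    (jcbNorm_add_le (oneMat φ) (oneMat ψ)).trans_lt (ENNReal.add_lt_top.2 ⟨hφ, hψ⟩)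
  smul_mem' := fun c φ hφ =>
    (jcbNorm_smul_le c (oneMat φ)).trans_lt (ENNReal.mul_lt_top ENNReal.ofReal_lt_top hφ)

variable (V W X) in
/-- The bilinear maps of finite type `(v, w) ↦ ∑ fᵢ(v) gᵢ(w) xᵢ`. -/
def finiteType : Submodule ℂ (V →L[ℂ] W →L[ℂ] X) :=
  Submodule.span ℂ {φ | ∃ (f : V →L[ℂ] ℂ) (g : W →L[ℂ] ℂ) (x : X), φ = f.smulRight (g.smulRight x)}

/-- The composition `s ∘ φ ∘ (r₁, r₂)`. -/
def comp3 {U₁ U₂ Y : Type*} [NormedAddCommGroup U₁] [NormedSpace ℂ U₁] [NormedAddCommGroup U₂]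
    [NormedSpace ℂ U₂] [NormedAddCommGroup Y] [NormedSpace ℂ Y] (s : X →L[ℂ] Y)
    (φ : V →L[ℂ] W →L[ℂ] X) (r₁ : U₁ →L[ℂ] V) (r₂ : U₂ →L[ℂ] W) : U₁ →L[ℂ] U₂ →L[ℂ] Y :=
  (ContinuousLinearMap.compL ℂ U₂ X Y s).comp (φ.bilinearComp r₁ r₂)

theorem comp3_apply {U₁ U₂ Y : Type*} [NormedAddCommGroup U₁] [NormedSpace ℂ U₁]
    [NormedAddCommGroup U₂] [NormedSpace ℂ U₂] [NormedAddCommGroup Y] [NormedSpace ℂ Y]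
    (s : X →L[ℂ] Y) (φ : V →L[ℂ] W →L[ℂ] X) (r₁ : U₁ →L[ℂ] V) (r₂ : U₂ →L[ℂ] W) (u₁ : U₁) (u₂ : U₂) :
    comp3 s φ r₁ r₂ u₁ u₂ = s (φ (r₁ u₁) (r₂ u₂)) := rfl

/-- The restriction of a bilinear map to `F₁ × F₂`. -/
def restr (F₁ : Submodule ℂ V) (F₂ : Submodule ℂ W) (φ : V →L[ℂ] W →L[ℂ] X) : F₁ →L[ℂ] F₂ →L[ℂ] X :=
  φ.bilinearComp F₁.subtypeL F₂.subtypeL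

end Maps

/-! ### The canonical map `Ψ` -/

section Psi

open UniformSpace

/-- The functional `φ ⊗ ψ` on `V ⊗ W` is bounded by `‖φ‖ ‖ψ‖` for the projective norm. -/
theorem norm_tensor_functional_le {V W : Type*} [SeminormedAddCommGroup V] [NormedSpace ℂ V]
    [OperatorSpace V] [SeminormedAddCommGroup W] [NormedSpace ℂ W] [OperatorSpace W]
    (f : V →L[ℂ] ℂ) (g : W →L[ℂ] ℂ) (L : ProjTensor V W →ₗ[ℂ] ℂ)
    (hL : ∀ (v : V) (w : W), L (v ⊗ₜ[ℂ] w : V ⊗[ℂ] W) = f v * g w) (u : ProjTensor V W) :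
    ‖L u‖ ≤ ‖f‖ * ‖g‖ * ‖u‖ := by
  have hlim : ∀ c, ‖u‖ < c → ‖L u‖ ≤ ‖f‖ * ‖g‖ * c := by
    intro c hc
    have hc0 : 0 ≤ c := (norm_nonneg u).trans hc.le
    obtain ⟨p, q, a, v, w, b, hu, hv, hw, ha, hb⟩ :=
      exists_rep_of_lt (V := V) (W := W) (u := Matrix.of fun (_ _ : Fin 1) => u) hc
    have e : L u = (a * kroneckerMap (· * ·) (v.map f) (w.map g) * b) 0 0 := by
      have h1 : u = ∑ k, ∑ l, (a 0 k * b l 0) • (v k.1 l.1 ⊗ₜ[ℂ] w k.2 l.2 : V ⊗[ℂ] W) :=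
        congrFun (congrFun hu 0) 0
      have h2 : L u = ∑ k, ∑ l, (a 0 k * b l 0) • (f (v k.1 l.1) * g (w k.2 l.2)) := by
        rw [h1]
        refine (map_sum L _ _).trans (Finset.sum_congr rfl fun k _ => ?_)
        refine (map_sum L _ _).trans (Finset.sum_congr rfl fun l _ => ?_)
        refine (map_smul L _ _).trans ?_
        rw [hL]
      rw [h2]
      simp only [Matrix.mul_apply, kroneckerMap_apply, Matrix.map_apply, Finset.sum_mul, smul_eq_mul]
      rw [Finset.sum_comm]
      refine Finset.sum_congr rfl fun k _ => Finset.sum_congr rfl fun l _ => ?_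
      ring
    have hf := sNorm_map_le f v
    have hg := sNorm_map_le g w
    rw [nrm_fin] at hf hg
    have hf' : sNorm (v.map f) ≤ ‖f‖ := hf.trans (mul_le_of_le_one_right (norm_nonneg _) hv)
    have hg' : sNorm (w.map g) ≤ ‖g‖ := hg.trans (mul_le_of_le_one_right (norm_nonneg _) hw)
    have n1 := sNorm_nonneg a
    have n2 := sNorm_nonneg b
    have n3 := sNorm_nonneg (v.map f)
    have n4 := sNorm_nonneg (w.map g)
    rw [e]
    refine (norm_entry_le_sNorm _ 0 0).trans ((sNorm_mul _ _).trans ?_)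
    calc _ ≤ (sNorm a * (sNorm (v.map f) * sNorm (w.map g))) * sNorm b := by
          refine mul_le_mul_of_nonneg_right ((sNorm_mul _ _).trans ?_) n2
          exact mul_le_mul_of_nonneg_left (sNorm_kron_le _ _) n1
      _ ≤ (Real.sqrt c * (‖f‖ * ‖g‖)) * Real.sqrt c := by gcongr
      _ = ‖f‖ * ‖g‖ * (Real.sqrt c * Real.sqrt c) := by ring
      _ = _ := by rw [Real.mul_self_sqrt hc0]
  have hcont : Filter.Tendsto (fun c : ℝ => ‖f‖ * ‖g‖ * c)
      (nhdsWithin ‖u‖ (Set.Ioi ‖u‖)) (nhds (‖f‖ * ‖g‖ * ‖u‖)) :=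
    (Continuous.tendsto (by fun_prop) _).mono_left nhdsWithin_le_nhds
  exact ge_of_tendsto hcont (by filter_upwards [self_mem_nhdsWithin] with c hc using hlim c hc)

/-- The continuous extension to the completion of a bounded linear map into a Banach space. -/
def extCompl {E F : Type*} [SeminormedAddCommGroup E] [NormedSpace ℂ E] [NormedAddCommGroup F]
    [NormedSpace ℂ F] [CompleteSpace F] (L : E →ₗ[ℂ] F) : Completion E →L[ℂ] F :=
  L.extendOfNorm (Completion.toComplₗᵢ (𝕜 := ℂ) (E := E)).toLinearMap

theorem extCompl_coe {E F : Type*} [SeminormedAddCommGroup E] [NormedSpace ℂ E]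
    [NormedAddCommGroup F] [NormedSpace ℂ F] [CompleteSpace F] (L : E →ₗ[ℂ] F)
    (hL : ∀ x, ‖L x‖ ≤ ‖x‖) (x : E) : extCompl L (x : Completion E) = L x :=
  LinearMap.extendOfNorm_eq (e := (Completion.toComplₗᵢ (𝕜 := ℂ) (E := E)).toLinearMap)
    Completion.denseRange_coe
    ⟨1, fun x => by
      rw [one_mul]
      exact (hL x).trans (Completion.norm_coe x).symm.le⟩ x

theorem norm_extCompl_le {E F : Type*} [SeminormedAddCommGroup E] [NormedSpace ℂ E]
    [NormedAddCommGroup F] [NormedSpace ℂ F] [CompleteSpace F] (L : E →ₗ[ℂ] F)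
    (hL : ∀ x, ‖L x‖ ≤ ‖x‖) (u : Completion E) : ‖extCompl L u‖ ≤ ‖u‖ := by
  have := LinearMap.norm_extendOfNorm_apply_le
    (e := (Completion.toComplₗᵢ (𝕜 := ℂ) (E := E)).toLinearMap) (f := L)
    Completion.denseRange_coe 1
    (fun x => by
      rw [one_mul]
      exact (hL x).trans (Completion.norm_coe x).symm.le) u
  rwa [one_mul] at this

variable (V W X : Type*) [NormedAddCommGroup V] [NormedSpace ℂ V] [OperatorSpace V]
  [NormedAddCommGroup W] [NormedSpace ℂ W] [OperatorSpace W]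
  [NormedAddCommGroup X] [NormedSpace ℂ X] [OperatorSpace X]

/-- The map `V* ⊗ W* → L(V × W, ℂ)`, `f ⊗ g ↦ ((v, w) ↦ f(v) g(w))`. -/
def psiForm₀ : ProjTensor (V →L[ℂ] ℂ) (W →L[ℂ] ℂ) →ₗ[ℂ] (V →L[ℂ] W →L[ℂ] ℂ) :=
  TensorProduct.lift (LinearMap.mk₂ ℂ (fun (f : V →L[ℂ] ℂ) (g : W →L[ℂ] ℂ) => f.smulRight g)
    (fun f f' g => by ext v w; simp [add_mul])
    (fun c f g => by ext v w; simp [mul_assoc])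
    (fun f g g' => by ext v w; simp [mul_add])
    (fun c f g => by ext v w; simp [mul_left_comm]))

theorem psiForm₀_tmul (f : V →L[ℂ] ℂ) (g : W →L[ℂ] ℂ) (v : V) (w : W) :
    psiForm₀ V W (f ⊗ₜ[ℂ] g : (V →L[ℂ] ℂ) ⊗[ℂ] (W →L[ℂ] ℂ)) v w = f v * g w := by
  have h : psiForm₀ V W (f ⊗ₜ[ℂ] g : (V →L[ℂ] ℂ) ⊗[ℂ] (W →L[ℂ] ℂ)) = f.smulRight g :=
    TensorProduct.lift.tmul _ _
  rw [h]
  simp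

variable {V} in
theorem norm_eval_le (v : V) : ‖(ContinuousLinearMap.apply ℂ ℂ v : (V →L[ℂ] ℂ) →L[ℂ] ℂ)‖ ≤ ‖v‖ :=
  ContinuousLinearMap.opNorm_le_bound _ (norm_nonneg _) fun f => by
    rw [mul_comm]; exact f.le_opNorm v

theorem norm_psiForm₀_le (u : ProjTensor (V →L[ℂ] ℂ) (W →L[ℂ] ℂ)) : ‖psiForm₀ V W u‖ ≤ ‖u‖ := by
  refine ContinuousLinearMap.opNorm_le_bound₂ _ (norm_nonneg _) fun v w => ?_
  have h := norm_tensor_functional_le (ContinuousLinearMap.apply ℂ ℂ v)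
    (ContinuousLinearMap.apply ℂ ℂ w)
    ((ContinuousLinearMap.apply ℂ ℂ w).toLinearMap ∘ₗ
      (ContinuousLinearMap.apply ℂ (W →L[ℂ] ℂ) v).toLinearMap ∘ₗ psiForm₀ V W)
    (fun f g => psiForm₀_tmul V W f g v w) u
  refine h.trans ?_
  calc _ ≤ ‖v‖ * ‖w‖ * ‖u‖ := by
        gcongr
        · exact norm_eval_le v
        · exact norm_eval_le w
    _ = _ := by ring

/-- The canonical map `V* ⊗^ W* → L(V × W, ℂ)` on the completed projective tensor product. -/
def psiForm : ProjCompl (V →L[ℂ] ℂ) (W →L[ℂ] ℂ) →L[ℂ] (V →L[ℂ] W →L[ℂ] ℂ) :=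
  extCompl (E := ProjTensor (V →L[ℂ] ℂ) (W →L[ℂ] ℂ)) (F := V →L[ℂ] W →L[ℂ] ℂ)
    (psiForm₀ V W)

theorem psiForm_coe (u : ProjTensor (V →L[ℂ] ℂ) (W →L[ℂ] ℂ)) :
    psiForm V W (u : ProjCompl (V →L[ℂ] ℂ) (W →L[ℂ] ℂ)) = psiForm₀ V W u :=
  extCompl_coe _ (norm_psiForm₀_le V W) u

theorem norm_psiForm_le (u : ProjCompl (V →L[ℂ] ℂ) (W →L[ℂ] ℂ)) : ‖psiForm V W u‖ ≤ ‖u‖ :=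
  norm_extCompl_le _ (norm_psiForm₀_le V W) u

/-- The map `(V* ⊗^ W*) ⊗ X → L(V × W, X)`, `a ⊗ x ↦ ((v, w) ↦ a(v, w) x)`. -/
def psi₀ : ProjTensor (ProjCompl (V →L[ℂ] ℂ) (W →L[ℂ] ℂ)) X →ₗ[ℂ] (V →L[ℂ] W →L[ℂ] X) :=
  TensorProduct.lift (LinearMap.mk₂ ℂ
    (fun (a : ProjCompl (V →L[ℂ] ℂ) (W →L[ℂ] ℂ)) (x : X) =>
      (ContinuousLinearMap.compL ℂ W ℂ X (ContinuousLinearMap.toSpanSingleton ℂ x)).comp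
        (psiForm V W a))
    (fun a a' x => by ext v w; simp [add_smul])
    (fun c a x => by ext v w; simp [mul_smul])
    (fun a x x' => by ext v w; simp)
    (fun c a x => by ext v w; simp [smul_smul, mul_comm]))

theorem psi₀_tmul (a : ProjCompl (V →L[ℂ] ℂ) (W →L[ℂ] ℂ)) (x : X) (v : V) (w : W) :
    psi₀ V W X (a ⊗ₜ[ℂ] x : ProjCompl (V →L[ℂ] ℂ) (W →L[ℂ] ℂ) ⊗[ℂ] X) v w
      = psiForm V W a v w • x := by
  have h : psi₀ V W X (a ⊗ₜ[ℂ] x : ProjCompl (V →L[ℂ] ℂ) (W →L[ℂ] ℂ) ⊗[ℂ] X)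
      = (ContinuousLinearMap.compL ℂ W ℂ X (ContinuousLinearMap.toSpanSingleton ℂ x)).comp
        (psiForm V W a) :=
    TensorProduct.lift.tmul _ _
  rw [h]
  simp

theorem norm_psi₀_le (u : ProjTensor (ProjCompl (V →L[ℂ] ℂ) (W →L[ℂ] ℂ)) X) :
    ‖psi₀ V W X u‖ ≤ ‖u‖ := by
  refine ContinuousLinearMap.opNorm_le_bound₂ _ (norm_nonneg _) fun v w => ?_
  refine NormedSpace.norm_le_dual_bound ℂ _ (by positivity) fun h => ?_
  let f : ProjCompl (V →L[ℂ] ℂ) (W →L[ℂ] ℂ) →L[ℂ] ℂ :=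
    (ContinuousLinearMap.apply ℂ ℂ w).comp
      ((ContinuousLinearMap.apply ℂ (W →L[ℂ] ℂ) v).comp (psiForm V W))
  have hf : ‖f‖ ≤ ‖v‖ * ‖w‖ := by
    refine ContinuousLinearMap.opNorm_le_bound _ (by positivity) fun a => ?_
    calc ‖psiForm V W a v w‖ ≤ ‖psiForm V W a‖ * ‖v‖ * ‖w‖ :=
          ContinuousLinearMap.le_opNorm₂ _ _ _
      _ ≤ ‖a‖ * ‖v‖ * ‖w‖ := by gcongr; exact norm_psiForm_le V W a
      _ = _ := by ring
  have key := norm_tensor_functional_le f h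
    (h.toLinearMap ∘ₗ (ContinuousLinearMap.apply ℂ X w).toLinearMap ∘ₗ
      (ContinuousLinearMap.apply ℂ (W →L[ℂ] X) v).toLinearMap ∘ₗ psi₀ V W X)
    (fun a x => by
      have h1 := congrArg h (psi₀_tmul V W X a x v w)
      rw [map_smul] at h1
      exact h1) u
  refine key.trans ?_
  calc _ ≤ (‖v‖ * ‖w‖) * ‖h‖ * ‖u‖ := by gcongr
    _ = _ := by ring

variable [CompleteSpace X]

/-- The canonical map `Ψ : (V* ⊗^ W*) ⊗^ X → L(V × W, X)`, determined by linearity, continuity and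
`Ψ((f ⊗ g) ⊗ x)(v, w) = f(v) g(w) x`. -/
def Psi : ProjCompl (ProjCompl (V →L[ℂ] ℂ) (W →L[ℂ] ℂ)) X →L[ℂ] (V →L[ℂ] W →L[ℂ] X) :=
  extCompl (E := ProjTensor (ProjCompl (V →L[ℂ] ℂ) (W →L[ℂ] ℂ)) X) (F := V →L[ℂ] W →L[ℂ] X)
    (psi₀ V W X)

theorem Psi_coe (u : ProjTensor (ProjCompl (V →L[ℂ] ℂ) (W →L[ℂ] ℂ)) X) :
    Psi V W X (u : ProjCompl (ProjCompl (V →L[ℂ] ℂ) (W →L[ℂ] ℂ)) X) = psi₀ V W X u :=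
  extCompl_coe _ (norm_psi₀_le V W X) u

/-- `Ψ((f ⊗ g) ⊗ x)(v, w) = f(v) g(w) x`. -/
theorem Psi_tmul (f : V →L[ℂ] ℂ) (g : W →L[ℂ] ℂ) (x : X) (v : V) (w : W) :
    let a : ProjTensor (V →L[ℂ] ℂ) (W →L[ℂ] ℂ) := (f ⊗ₜ[ℂ] g : (V →L[ℂ] ℂ) ⊗[ℂ] (W →L[ℂ] ℂ))
    let b : ProjTensor (ProjCompl (V →L[ℂ] ℂ) (W →L[ℂ] ℂ)) X :=
      ((a : ProjCompl (V →L[ℂ] ℂ) (W →L[ℂ] ℂ)) ⊗ₜ[ℂ] x :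
        ProjCompl (V →L[ℂ] ℂ) (W →L[ℂ] ℂ) ⊗[ℂ] X)
    Psi V W X (b : ProjCompl (ProjCompl (V →L[ℂ] ℂ) (W →L[ℂ] ℂ)) X) v w = (f v * g w) • x := by
  intro a b
  rw [Psi_coe]
  refine (psi₀_tmul V W X a x v w).trans ?_
  rw [psiForm_coe]
  exact congrArg (· • x) (psiForm₀_tmul V W f g v w)

end Psi

/-! ### Completely nuclear and completely integral bilinear maps -/

section Nuclear

variable (V W X : Type*) [NormedAddCommGroup V] [NormedSpace ℂ V] [OperatorSpace V]
  [NormedAddCommGroup W] [NormedSpace ℂ W] [OperatorSpace W]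
  [NormedAddCommGroup X] [NormedSpace ℂ X] [OperatorSpace X] [CompleteSpace X]

/-- The space `N(V × W, X)` of completely nuclear bilinear maps: the image of `Ψ`. -/
def nuclear : Submodule ℂ (V →L[ℂ] W →L[ℂ] X) := LinearMap.range (Psi V W X).toLinearMap

variable {V W X}

/-- The completely nuclear norm: the quotient matrix norm of `((V* ⊗^ W*) ⊗^ X) / ker Ψ`.  It is
`∞` if some entry of `Φ` is not completely nuclear. -/
def nuclearNorm {n : ℕ} (Φ : Matrix (Fin n) (Fin n) (V →L[ℂ] W →L[ℂ] X)) : ENNReal :=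
  ⨅ (u : Matrix (Fin n) (Fin n) (ProjCompl (ProjCompl (V →L[ℂ] ℂ) (W →L[ℂ] ℂ)) X))
    (_ : u.map (Psi V W X) = Φ), ENNReal.ofReal (mnorm n u)

/-- The completely integral norm: the supremum of the completely nuclear norms of the restrictions
to finite-dimensional subspaces. -/
def integralNorm {n : ℕ} (Φ : Matrix (Fin n) (Fin n) (V →L[ℂ] W →L[ℂ] X)) : ENNReal :=
  ⨆ (F₁ : Submodule ℂ V) (F₂ : Submodule ℂ W) (_ : FiniteDimensional ℂ F₁)
    (_ : FiniteDimensional ℂ F₂), nuclearNorm (Φ.map (restr F₁ F₂))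

theorem nuclearNorm_add_le {n : ℕ} (Φ Φ' : Matrix (Fin n) (Fin n) (V →L[ℂ] W →L[ℂ] X)) :
    nuclearNorm (Φ + Φ') ≤ nuclearNorm Φ + nuclearNorm Φ' := by
  simp only [nuclearNorm, ENNReal.iInf_add, ENNReal.add_iInf]
  refine le_iInf fun u => le_iInf fun hu => le_iInf fun u' => le_iInf fun hu' => ?_
  refine iInf₂_le_of_le (u' + u) ?_ ?_
  · rw [← hu, ← hu']
    ext
    simp [add_comm]
  · exact (ENNReal.ofReal_le_ofReal (isSeminorm.add_le _ _ _)).trans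
      (ENNReal.ofReal_add_le.trans (by rw [add_comm]))

theorem nuclearNorm_smul_le {n : ℕ} (c : ℂ) (Φ : Matrix (Fin n) (Fin n) (V →L[ℂ] W →L[ℂ] X)) :
    nuclearNorm (c • Φ) ≤ ENNReal.ofReal ‖c‖ * nuclearNorm Φ := by
  by_cases hc : c = 0
  · subst hc
    refine iInf₂_le_of_le 0 (by ext; simp) ?_
    have := (isSeminorm (V := ProjCompl (ProjCompl (V →L[ℂ] ℂ) (W →L[ℂ] ℂ)) X)).smul n 0 0
    rw [zero_smul, norm_zero, zero_mul] at this
    simp [this]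
  · have h0 : ENNReal.ofReal ‖c‖ ≠ 0 := by simpa using hc
    rw [nuclearNorm, nuclearNorm, ENNReal.mul_iInf_of_ne h0 ENNReal.ofReal_ne_top]
    refine le_iInf fun u => ?_
    rw [ENNReal.mul_iInf_of_ne h0 ENNReal.ofReal_ne_top]
    refine le_iInf fun hu => ?_
    refine iInf₂_le_of_le (c • u) (by rw [← hu]; ext; simp) ?_
    rw [isSeminorm.smul, ENNReal.ofReal_mul (norm_nonneg _)]

theorem integralNorm_add_le {n : ℕ} (Φ Φ' : Matrix (Fin n) (Fin n) (V →L[ℂ] W →L[ℂ] X)) :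
    integralNorm (Φ + Φ') ≤ integralNorm Φ + integralNorm Φ' := by
  refine iSup_le fun F₁ => iSup_le fun F₂ => iSup_le fun h₁ => iSup_le fun h₂ => ?_
  have e : (Φ + Φ').map (restr F₁ F₂) = Φ.map (restr F₁ F₂) + Φ'.map (restr F₁ F₂) := rfl
  rw [e]
  refine (nuclearNorm_add_le _ _).trans (add_le_add ?_ ?_)
  · exact le_iSup_of_le F₁ (le_iSup_of_le F₂ (le_iSup_of_le h₁ (le_iSup_of_le h₂ le_rfl)))
  · exact le_iSup_of_le F₁ (le_iSup_of_le F₂ (le_iSup_of_le h₁ (le_iSup_of_le h₂ le_rfl)))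

theorem integralNorm_smul_le {n : ℕ} (c : ℂ) (Φ : Matrix (Fin n) (Fin n) (V →L[ℂ] W →L[ℂ] X)) :
    integralNorm (c • Φ) ≤ ENNReal.ofReal ‖c‖ * integralNorm Φ := by
  refine iSup_le fun F₁ => iSup_le fun F₂ => iSup_le fun h₁ => iSup_le fun h₂ => ?_
  have e : (c • Φ).map (restr F₁ F₂) = c • Φ.map (restr F₁ F₂) := rfl
  rw [e]
  refine (nuclearNorm_smul_le _ _).trans ?_
  gcongr
  exact le_iSup_of_le F₁ (le_iSup_of_le F₂ (le_iSup_of_le h₁ (le_iSup_of_le h₂ le_rfl)))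

variable (V W X) in
/-- The space `I(V × W, X)` of completely integral bilinear maps. -/
def integral : Submodule ℂ (V →L[ℂ] W →L[ℂ] X) where
  carrier := {φ | φ ∈ JCB V W X ∧ integralNorm (oneMat φ) < ⊤}
  zero_mem' := by
    refine ⟨zero_mem _, ?_⟩
    have e : (0 : ℂ) • oneMat (0 : V →L[ℂ] W →L[ℂ] X) = oneMat 0 := by ext; simp [oneMat]
    have h := integralNorm_smul_le 0 (oneMat (0 : V →L[ℂ] W →L[ℂ] X))
    rw [e, norm_zero, ENNReal.ofReal_zero, zero_mul] at h
    exact h.trans_lt ENNReal.zero_lt_top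
  add_mem' := fun {φ ψ} hφ hψ => ⟨add_mem hφ.1 hψ.1,
    (integralNorm_add_le (oneMat φ) (oneMat ψ)).trans_lt (ENNReal.add_lt_top.2 ⟨hφ.2, hψ.2⟩)⟩
  smul_mem' := fun c φ hφ => ⟨Submodule.smul_mem _ c hφ.1,
    (integralNorm_smul_le c (oneMat φ)).trans_lt (ENNReal.mul_lt_top ENNReal.ofReal_lt_top hφ.2)⟩

end Nuclear

/-! ### Operator space bilinear ideals -/

/-- A complete operator space. -/
structure COS : Type (u + 1) where
  carrier : Type u
  [normedAddCommGroup : NormedAddCommGroup carrier]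
  [normedSpace : NormedSpace ℂ carrier]
  [completeSpace : CompleteSpace carrier]
  [operatorSpace : OperatorSpace carrier]

instance : CoeSort COS.{u} (Type u) := ⟨COS.carrier⟩

attribute [instance] COS.normedAddCommGroup COS.normedSpace COS.completeSpace COS.operatorSpace

/-- An operator space bilinear ideal: an assignment `𝔄` of a linear subspace of `JCB(V × W, X)`,
containing the bilinear maps of finite type, to all complete operator spaces `V`, `W`, `X`,
together with operator space matrix norms `N` on these subspaces, such that (a) the norm dominates
the `jcb` norm and (b) the ideal property holds. -/
structure IsBilinearIdeal
    (𝔄 : ∀ V W X : COS.{u}, Submodule ℂ (V →L[ℂ] W →L[ℂ] X))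
    (N : ∀ (V W X : COS.{u}) (n : ℕ), Matrix (Fin n) (Fin n) (𝔄 V W X) → ℝ) : Prop where
  le_JCB : ∀ V W X : COS.{u}, 𝔄 V W X ≤ JCB V W X
  finiteType_le : ∀ V W X : COS.{u}, finiteType V W X ≤ 𝔄 V W X
  isOperatorSpaceNorm : ∀ V W X : COS.{u}, IsOperatorSpaceNorm (N V W X)
  jcbNorm_le : ∀ (V W X : COS.{u}) (n : ℕ) (Φ : Matrix (Fin n) (Fin n) (𝔄 V W X)),
    jcbNorm (Φ.map fun φ => (φ : V →L[ℂ] W →L[ℂ] X)) ≤ ENNReal.ofReal (N V W X n Φ)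
  comp_mem : ∀ (V W X U₁ U₂ Y : COS.{u}) (r₁ : U₁ →L[ℂ] V) (r₂ : U₂ →L[ℂ] W) (s : X →L[ℂ] Y),
    cbNorm r₁ < ⊤ → cbNorm r₂ < ⊤ → cbNorm s < ⊤ →
    ∀ φ ∈ 𝔄 V W X, comp3 s φ r₁ r₂ ∈ 𝔄 U₁ U₂ Y
  comp_le : ∀ (V W X U₁ U₂ Y : COS.{u}) (r₁ : U₁ →L[ℂ] V) (r₂ : U₂ →L[ℂ] W) (s : X →L[ℂ] Y),
    cbNorm r₁ < ⊤ → cbNorm r₂ < ⊤ → cbNorm s < ⊤ →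
    ∀ (n : ℕ) (Φ : Matrix (Fin n) (Fin n) (𝔄 V W X)) (Φ' : Matrix (Fin n) (Fin n) (𝔄 U₁ U₂ Y)),
      (∀ i j, (Φ' i j : U₁ →L[ℂ] U₂ →L[ℂ] Y) = comp3 s (Φ i j) r₁ r₂) →
      N U₁ U₂ Y n Φ' ≤ (cbNorm s).toReal * N V W X n Φ * (cbNorm r₁).toReal * (cbNorm r₂).toReal

/-- The matrix norm of `N(V × W, X)`, as a real number. -/
def nuclearMatrixNorm (V W X : COS.{u}) (n : ℕ) (Φ : Matrix (Fin n) (Fin n) (nuclear V W X)) : ℝ :=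
  (nuclearNorm (Φ.map fun φ => (φ : V →L[ℂ] W →L[ℂ] X))).toReal

/-- The matrix norm of `I(V × W, X)`, as a real number. -/
def integralMatrixNorm (V W X : COS.{u}) (n : ℕ) (Φ : Matrix (Fin n) (Fin n) (integral V W X)) :
    ℝ :=
  (integralNorm (Φ.map fun φ => (φ : V →L[ℂ] W →L[ℂ] X))).toReal

end OpSp

end

noncomputable section

namespace OpSp

open Matrix OperatorSpace UniformSpace
open scoped TensorProduct

/-! ### Completely bounded maps and their tensor products -/

section CBBound

/-! Everything rests on the functoriality of the projective tensor product. A matrix over `V ⊗ W` of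
norm less than `c` can be written `α (v ⊗ w) β` with `v`, `w` in the closed unit balls and `‖α‖, ‖β‖
≤ √c` (`exists_rep_of_lt`). Hence completely bounded maps can be tensored, their constants multiply,
and the bound survives completion by density (`exists_projCompl_map`).

For the ideal property of `N`, the map `(r₁* ⊗ r₂*) ⊗ s` covers, along `Ψ`, the operation `φ ↦ s ∘ φ
∘ (r₁, r₂)` (`exists_lift_comp3`). It carries preimages under `Ψ` to preimages and multiplies their
norms by at most `‖r₁‖ ‖r₂‖ ‖s‖`, so the quotient norm obeys the same bound. Restriction to `F₁ ×
F₂` is the case where `r₁`, `r₂` are inclusions, which gives `‖·‖_I ≤ ‖·‖_N`.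

For the comparison with the `jcb` norm, `Ψ` is completely contractive into `JCB`
(`nrm_ampl_Psi_le`). If `u = α (a ⊗ x) β`, then the matrix of values of `Ψ(u)` at `v`, `w` is `(1 ⊗
α)(A ⊗ x)(1 ⊗ β)`, where `A` is the scalar matrix of values of the forms `a`. If moreover `a = α' (f
⊗ g) β'`, then `A` is `(1 ⊗ α')(⟨f, v⟩ ⊗ ⟨g, w⟩)(1 ⊗ β')` up to regrouping of indices. Cross norm
inequalities give the bound at both stages, so `‖·‖_jcb ≤ ‖·‖_N`. A pair of matrices `v`, `w` has
finitely many entries, so the `jcb` norm is already seen on finite-dimensional subspaces and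
`‖·‖_jcb ≤ ‖·‖_I` follows.

The ideal property passes to `I` because the restriction of `s ∘ φ ∘ (r₁, r₂)` to `F₁ × F₂` factors
through the restriction of `φ` to `r₁ F₁ × r₂ F₂`. The axioms M1 and M2 come from direct sums and
scalar compressions of preimages, and both norms are definite because they dominate the `jcb` norm.
-/

/-- The linear map `T` is completely bounded with constant `c`. -/
structure CBBound {V W : Type*} [SeminormedAddCommGroup V] [NormedSpace ℂ V] [OperatorSpace V]
    [SeminormedAddCommGroup W] [NormedSpace ℂ W] [OperatorSpace W] (T : V →L[ℂ] W) (c : ℝ) :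
    Prop where
  nonneg : 0 ≤ c
  le : ∀ (m : ℕ) (v : Matrix (Fin m) (Fin m) V), mnorm m (v.map T) ≤ c * mnorm m v

variable {V W V' W' : Type*} [SeminormedAddCommGroup V] [NormedSpace ℂ V] [OperatorSpace V]
  [SeminormedAddCommGroup W] [NormedSpace ℂ W] [OperatorSpace W]
  [SeminormedAddCommGroup V'] [NormedSpace ℂ V'] [OperatorSpace V']
  [SeminormedAddCommGroup W'] [NormedSpace ℂ W'] [OperatorSpace W']

/-- The matrix norms of a completion are continuous, so the inequality is a closed condition and
needs checking only on the dense set of matrices over `V`. -/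
theorem CBBound.completion {T : V →L[ℂ] W} {c : ℝ} (hT : CBBound T c) :
    CBBound T.completion c where
  nonneg := hT.nonneg
  le m v := by
    refine coeM_denseRange.induction_on
      (p := fun u : Matrix (Fin m) (Fin m) (Completion V) =>
        mnorm m (u.map T.completion) ≤ c * mnorm m u) v ?_ ?_
    · refine isClosed_le (complNorm_continuous.comp ?_) (continuous_const.mul complNorm_continuous)
      exact continuous_id.matrix_map T.completion.continuous
    · intro a
      have e : (coeM a).map T.completion = coeM (a.map T) := by
        ext i j
        simp [coeM, ContinuousLinearMap.completion_apply_coe]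
      rw [e]
      have h := hT.le m a
      rw [← nrm_fin, ← nrm_fin, ← complNorm_coe, ← complNorm_coe] at h
      exact h

/-- The linear map `T ⊗ S` between algebraic tensor products. -/
def projMap (T : V →L[ℂ] V') (S : W →L[ℂ] W') : ProjTensor V W →ₗ[ℂ] ProjTensor V' W' :=
  TensorProduct.map T.toLinearMap S.toLinearMap

/-- Applying `T ⊗ S` to a representation `α (v ⊗ w) β` keeps the scalar matrices and replaces `v`,
`w` by their images, whose norms grow by at most `a` and `b`. -/
theorem mnorm_projMap_le {T : V →L[ℂ] V'} {S : W →L[ℂ] W'} {a b : ℝ} (hT : CBBound T a)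
    (hS : CBBound S b) (n : ℕ) (u : Matrix (Fin n) (Fin n) (ProjTensor V W)) :
    mnorm n (u.map (projMap T S)) ≤ a * b * mnorm n u := by
  have ha := hT.nonneg
  have hb := hS.nonneg
  -- The infimum in the projective norm need not be attained, so the estimate is made for every `c`
  -- above the norm; then `c` decreases to it.
  have hlim : ∀ c, mnorm n u < c → mnorm n (u.map (projMap T S)) ≤ a * b * c := by
    intro c hc
    have hc0 : 0 ≤ c := (isSeminorm.nonneg n u).trans hc.le
    obtain ⟨p, q, α, v, w, β, hu, hv, hw, hα, hβ⟩ :=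
      exists_rep_of_lt (V := V) (W := W) (u := u) hc
    have e : u.map (projMap T S) = sand α (kron (v.map T) (w.map S)) β := by
      rw [hu]
      refine (sand_map (TensorProduct.map T.toLinearMap S.toLinearMap) α (kron v w) β).trans ?_
      congr 1
    rw [e]
    refine (projNorm_le _ _ _ _).trans ?_
    have n1 := sNorm_nonneg α
    have n2 := sNorm_nonneg β
    have n3 := ruan.nonneg _ (v.map T)
    have n4 := ruan.nonneg _ (w.map S)
    have h1 : nrm _ (v.map T) ≤ a * 1 := by
      rw [nrm_fin]; exact (hT.le _ _).trans (by gcongr)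
    have h2 : nrm _ (w.map S) ≤ b * 1 := by
      rw [nrm_fin]; exact (hS.le _ _).trans (by gcongr)
    calc _ ≤ Real.sqrt c * (a * 1) * (b * 1) * Real.sqrt c := by gcongr
      _ = a * b * (Real.sqrt c * Real.sqrt c) := by ring
      _ = _ := by rw [Real.mul_self_sqrt hc0]
  have hcont : Filter.Tendsto (fun c : ℝ => a * b * c)
      (nhdsWithin (mnorm n u) (Set.Ioi (mnorm n u))) (nhds (a * b * mnorm n u)) :=
    (Continuous.tendsto (by fun_prop) _).mono_left nhdsWithin_le_nhds
  exact ge_of_tendsto hcont (by filter_upwards [self_mem_nhdsWithin] with c hc using hlim c hc)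

/-- The elementary tensor `v ⊗ w` in `V ⊗^ W`. -/
def ptmul (v : V) (w : W) : ProjCompl V W :=
  let t : ProjTensor V W := (v ⊗ₜ[ℂ] w : V ⊗[ℂ] W)
  t

/-- The tensor product of completely bounded maps is completely bounded. -/
theorem exists_projCompl_map {T : V →L[ℂ] V'} {S : W →L[ℂ] W'} {a b : ℝ} (hT : CBBound T a)
    (hS : CBBound S b) : ∃ R : ProjCompl V W →L[ℂ] ProjCompl V' W', CBBound R (a * b) ∧
      ∀ v w, R (ptmul v w) = ptmul (T v) (S w) := by
  -- The norm of `V ⊗ W` is the first matrix level, so the case of `1 × 1` matrices supplies the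
  -- continuity needed to pass to the completion.
  let R₀ : ProjTensor V W →L[ℂ] ProjTensor V' W' := (projMap T S).mkContinuous (a * b) fun u => by
    have h := mnorm_projMap_le hT hS 1 (Matrix.of fun _ _ => u)
    rwa [mnorm_one, mnorm_one] at h
  refine ⟨R₀.completion, CBBound.completion
    ⟨mul_nonneg hT.nonneg hS.nonneg, mnorm_projMap_le hT hS⟩, fun v w => ?_⟩
  refine (ContinuousLinearMap.completion_apply_coe R₀ _).trans ?_
  rfl

/-- Continuous linear maps on `V ⊗^ W` are determined by their values on elementary tensors. -/
theorem projCompl_ext {F : Type*} [NormedAddCommGroup F] [NormedSpace ℂ F]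
    {P Q : ProjCompl V W →L[ℂ] F} (h : ∀ v w, P (ptmul v w) = Q (ptmul v w)) : P = Q := by
  ext u
  refine Completion.denseRange_coe.induction_on
    (p := fun u => P u = Q u) u (isClosed_eq P.continuous Q.continuous) fun t => ?_
  have : P.toLinearMap ∘ₗ (Completion.toComplₗᵢ (𝕜 := ℂ) (E := ProjTensor V W)).toLinearMap
      = Q.toLinearMap ∘ₗ (Completion.toComplₗᵢ (𝕜 := ℂ) (E := ProjTensor V W)).toLinearMap :=
    TensorProduct.ext' (M := V) (N := W) h
  exact LinearMap.congr_fun this t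

end CBBound

/-! ### Constructions with completely bounded maps and lifting of compositions along `Ψ` -/

section Nuclear

variable {V W X U₁ U₂ Y : Type*} [NormedAddCommGroup V] [NormedSpace ℂ V] [OperatorSpace V]
  [NormedAddCommGroup W] [NormedSpace ℂ W] [OperatorSpace W]
  [NormedAddCommGroup X] [NormedSpace ℂ X] [OperatorSpace X]
  [NormedAddCommGroup U₁] [NormedSpace ℂ U₁] [OperatorSpace U₁]
  [NormedAddCommGroup U₂] [NormedSpace ℂ U₂] [OperatorSpace U₂]
  [NormedAddCommGroup Y] [NormedSpace ℂ Y] [OperatorSpace Y]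

/-- `cbNorm` only tests the unit ball; homogeneity spreads the bound to all matrices. -/
theorem CBBound.of_cbNorm {r : V →L[ℂ] W} (hr : cbNorm r < ⊤) : CBBound r (cbNorm r).toReal where
  nonneg := ENNReal.toReal_nonneg
  le m v := by
    have hn := isSeminorm.nonneg m v
    rcases hn.eq_or_lt with h0 | h0
    -- A matrix of norm zero cannot be normalised, but it vanishes since the matrix norms of `V` are
    -- definite.
    · have hv := isOperatorSpaceNorm.eq_zero m v h0.symm
      have h2 : mnorm m ((0 : Matrix (Fin m) (Fin m) V).map r) = 0 := by
        have := (isSeminorm (V := W)).smul m 0 0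
        rw [zero_smul, norm_zero, zero_mul] at this
        rwa [Matrix.map_zero _ (map_zero r)]
      rw [hv, h2, ← hv, ← h0, mul_zero]
    · set c : ℂ := ((mnorm m v)⁻¹ : ℂ)
      have hc : ‖c‖ = (mnorm m v)⁻¹ := by
        rw [norm_inv, Complex.norm_real, Real.norm_of_nonneg hn]
      have h1 : mnorm m (c • v) ≤ 1 := by rw [isSeminorm.smul, hc, inv_mul_cancel₀ h0.ne']
      have h2 : ENNReal.ofReal (mnorm m ((c • v).map r)) ≤ cbNorm r :=
        le_iSup_of_le m (le_iSup_of_le (c • v) (le_iSup_of_le h1 le_rfl))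
      have e : (c • v).map r = c • v.map r := by ext; simp
      rw [e, isSeminorm.smul, hc, ENNReal.ofReal_le_iff_le_toReal hr.ne,
        inv_mul_le_iff₀ h0] at h2
      exact h2.trans (mul_comm _ _).le

theorem CBBound.subtypeL (F : Submodule ℂ V) : CBBound F.subtypeL 1 where
  nonneg := zero_le_one
  le _ _ := (one_mul _).symm.le

theorem CBBound.id : CBBound (ContinuousLinearMap.id ℂ V) 1 where
  nonneg := zero_le_one
  le _ v := (one_mul (mnorm _ v)).symm.le

/-- The restriction of a completely bounded map to subspaces. -/
theorem CBBound.restrict {r : V →L[ℂ] W} {c : ℝ} (hr : CBBound r c) (F : Submodule ℂ V)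
    (G : Submodule ℂ W) (h : ∀ x : F, r x ∈ G) :
    CBBound ((r.comp F.subtypeL).codRestrict G h) c where
  nonneg := hr.nonneg
  le m v := hr.le m (v.map fun x : F => (x : V))

/-- The adjoint of a completely bounded map. -/
theorem CBBound.adjoint {r : V →L[ℂ] W} {c : ℝ} (hr : CBBound r c) :
    CBBound (ContinuousLinearMap.precomp ℂ r : (W →L[ℂ] ℂ) →L[ℂ] (V →L[ℂ] ℂ)) c where
  nonneg := hr.nonneg
  le n f := by
    refine dualNorm_le_of _ (mul_nonneg hr.nonneg (dualNorm_nonneg f)) fun m v hv => ?_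
    -- Duality on the nose: pairing `r* f` with `v` is pairing `f` with `r v`.
    have e : pairing (f.map (ContinuousLinearMap.precomp ℂ r)) v = pairing f (v.map r) := rfl
    rw [e]
    refine (sNorm_pairing_le_dualNorm f _).trans ?_
    rw [mul_comm]
    refine mul_le_mul_of_nonneg_right ?_ (dualNorm_nonneg f)
    exact (hr.le m v).trans (mul_le_of_le_one_right hr.nonneg hv)

theorem psiForm_ptmul (f : V →L[ℂ] ℂ) (g : W →L[ℂ] ℂ) (v : V) (w : W) :
    psiForm V W (ptmul f g) v w = f v * g w := by
  refine (congrArg (fun φ => φ v w) (psiForm_coe V W _)).trans ?_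
  exact psiForm₀_tmul V W f g v w

variable [CompleteSpace X] [CompleteSpace Y]

theorem Psi_ptmul (a : ProjCompl (V →L[ℂ] ℂ) (W →L[ℂ] ℂ)) (x : X) (v : V) (w : W) :
    Psi V W X (ptmul a x) v w = psiForm V W a v w • x := by
  refine (congrArg (fun φ => φ v w) (Psi_coe V W X _)).trans ?_
  exact psi₀_tmul V W X a x v w

/-- The map `(V* ⊗^ W*) ⊗^ X → (U₁* ⊗^ U₂*) ⊗^ Y` inducing `φ ↦ s ∘ φ ∘ (r₁, r₂)`. -/
theorem exists_lift_comp3 {r₁ : U₁ →L[ℂ] V} {r₂ : U₂ →L[ℂ] W} {s : X →L[ℂ] Y} {a b c : ℝ}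
    (h₁ : CBBound r₁ a) (h₂ : CBBound r₂ b) (hs : CBBound s c) :
    ∃ R : ProjCompl (ProjCompl (V →L[ℂ] ℂ) (W →L[ℂ] ℂ)) X →L[ℂ]
        ProjCompl (ProjCompl (U₁ →L[ℂ] ℂ) (U₂ →L[ℂ] ℂ)) Y,
      CBBound R (a * b * c) ∧ ∀ u, Psi U₁ U₂ Y (R u) = comp3 s (Psi V W X u) r₁ r₂ := by
  -- `P = r₁* ⊗ r₂*` and `R = P ⊗ s`.
  obtain ⟨P, hP, hP'⟩ := exists_projCompl_map h₁.adjoint h₂.adjoint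
  obtain ⟨R, hR, hR'⟩ := exists_projCompl_map hP hs
  refine ⟨R, hR, fun u => ?_⟩
  ext u₁ u₂
  -- Two layers of completed tensor products call for two density arguments. After evaluation at
  -- fixed vectors both sides are continuous linear maps, so elementary tensors decide: first `f ⊗
  -- g` for the forms, then `t ⊗ x` with `t` arbitrary in `V* ⊗^ W*`.
  have e₁ : (ContinuousLinearMap.apply ℂ ℂ u₂).comp ((ContinuousLinearMap.apply ℂ _ u₁).comp
      ((psiForm U₁ U₂).comp P)) = (ContinuousLinearMap.apply ℂ ℂ (r₂ u₂)).comp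
        ((ContinuousLinearMap.apply ℂ _ (r₁ u₁)).comp (psiForm V W)) := by
    refine projCompl_ext fun f g => ?_
    simp [hP', psiForm_ptmul]
  have e₂ : (ContinuousLinearMap.apply ℂ Y u₂).comp ((ContinuousLinearMap.apply ℂ _ u₁).comp
      ((Psi U₁ U₂ Y).comp R)) = s.comp ((ContinuousLinearMap.apply ℂ X (r₂ u₂)).comp
        ((ContinuousLinearMap.apply ℂ _ (r₁ u₁)).comp (Psi V W X))) := by
    refine projCompl_ext fun t x => ?_
    have h := DFunLike.congr_fun e₁ t
    simp only [ContinuousLinearMap.comp_apply, ContinuousLinearMap.apply_apply] at h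
    simp [hR', Psi_ptmul, h]
  exact DFunLike.congr_fun e₂ u

end Nuclear

/-! ### The jointly completely bounded norm is dominated by the completely nuclear norm -/

section Jcb

theorem sNorm_continuous {ι κ : Type} [Fintype ι] [Fintype κ] :
    Continuous (sNorm : Matrix ι κ ℂ → ℝ) := by
  classical
  open scoped Matrix.Norms.L2Operator in exact continuous_norm

theorem nrm_continuous {A : Type*} [SeminormedAddCommGroup A] [NormedSpace ℂ A] [OperatorSpace A]
    {ι : Type} [Fintype ι] : Continuous (nrm ι : Matrix ι ι A → ℝ) :=
  nrm_uniformContinuous.continuous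

/-- The block diagonal matrix with equal blocks `x`. -/
def diagRep {X : Type*} [Zero X] (κ : Type) [DecidableEq κ] {δ : Type} (x : Matrix δ δ X) :
    Matrix (κ × δ) (κ × δ) X :=
  Matrix.of fun a b => if a.1 = b.1 then x a.2 b.2 else 0

/-- Induction with M1: one more copy of `x` is one more diagonal block, and the maximum does not
grow. -/
theorem nrm_diagRep_fin_le {X : Type*} [SeminormedAddCommGroup X] [NormedSpace ℂ X]
    [OperatorSpace X] {δ : Type} [Fintype δ] (x : Matrix δ δ X) (n : ℕ) :
    nrm _ (diagRep (Fin n) x) ≤ nrm δ x := by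
  induction n with
  | zero =>
    have e : diagRep (Fin 0) x = 0 := by ext a; exact a.1.elim0
    rw [e]
    exact ruan.zero.le.trans (ruan.nonneg _ _)
  | succ n ih =>
    let e : (Fin n × δ) ⊕ (Fin 1 × δ) ≃ Fin (n + 1) × δ :=
      (Equiv.sumProdDistrib _ _ _).symm.trans (Equiv.prodCongr finSumFinEquiv (Equiv.refl δ))
    rw [← ruan.submatrix_equiv e]
    have h : (diagRep (Fin (n + 1)) x).submatrix e e
        = fromBlocks (diagRep (Fin n) x) 0 0 (x.submatrix Prod.snd Prod.snd) := by
      ext (⟨i, k⟩ | ⟨i, k⟩) (⟨j, l⟩ | ⟨j, l⟩)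
      · simp [diagRep, e, Fin.ext_iff]
      · have := i.isLt
        simp [diagRep, e, Fin.ext_iff]
        omega
      · have := j.isLt
        simp [diagRep, e, Fin.ext_iff]
        omega
      · simp [diagRep, e, Subsingleton.elim i j]
    rw [h]
    refine (ruan.blocks _ _ _ _).trans (max_le ih ?_)
    refine ruan.submatrix_le ?_ x
    rintro ⟨i, k⟩ ⟨j, l⟩ hkl
    exact Prod.ext (Subsingleton.elim _ _) hkl

theorem nrm_diagRep_le {X : Type*} [SeminormedAddCommGroup X] [NormedSpace ℂ X]
    [OperatorSpace X] {κ δ : Type} [Fintype κ] [DecidableEq κ] [Fintype δ] (x : Matrix δ δ X) :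
    nrm _ (diagRep κ x) ≤ nrm δ x := by
  refine le_trans (le_of_eq ?_) (nrm_diagRep_fin_le x (Fintype.card κ))
  rw [← ruan.submatrix_equiv (Equiv.prodCongr (Fintype.equivFin κ) (Equiv.refl δ))]
  congr 1
  ext a b
  simp [diagRep]

/-- The cross norm inequality for a scalar matrix and a matrix over an operator space. -/
theorem nrm_scalar_kron_le {X : Type*} [SeminormedAddCommGroup X] [NormedSpace ℂ X]
    [OperatorSpace X] {κ δ : Type} [Fintype κ] [Fintype δ] (C : Matrix κ κ ℂ)
    (x : Matrix δ δ X) :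
    nrm _ (Matrix.of fun a b : κ × δ => C a.1 b.1 • x a.2 b.2) ≤ sNorm C * nrm δ x := by
  classical
  -- `C ⊗ x = (C ⊗ 1)(1 ⊗ x)`, where `1 ⊗ x` is block diagonal; M2 then gives the factor `‖C‖` and
  -- M1 bounds `1 ⊗ x`.
  have e : (Matrix.of fun a b : κ × δ => C a.1 b.1 • x a.2 b.2)
      = sand (kroneckerMap (· * ·) C (1 : Matrix δ δ ℂ)) (diagRep κ x) 1 := by
    ext ⟨i, k⟩ ⟨j, l⟩
    simp [sand, diagRep, Fintype.sum_prod_type, Matrix.one_apply, Prod.ext_iff, ite_and]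
  rw [e]
  refine (ruan.sand _ _ _ _ _).trans ?_
  have h1 := sNorm_kron_one_le (μ := δ) C
  have h2 := sNorm_one_le (ι := κ × δ)
  have h3 := nrm_diagRep_le (κ := κ) x
  have n1 := sNorm_nonneg C
  have n2 := ruan.nonneg _ x
  have n3 := ruan.nonneg _ (diagRep κ x)
  have n4 := sNorm_nonneg (1 : Matrix (κ × δ) (κ × δ) ℂ)
  calc _ ≤ sNorm C * nrm δ x * 1 := by gcongr
    _ = _ := mul_one _

/-! ### Complete contractivity of `Ψ` into the jointly completely bounded maps -/

variable {V W X : Type*} [NormedAddCommGroup V] [NormedSpace ℂ V] [OperatorSpace V]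
  [NormedAddCommGroup W] [NormedSpace ℂ W] [OperatorSpace W]
  [NormedAddCommGroup X] [NormedSpace ℂ X] [OperatorSpace X]

/-- The scalar matrix `(a_{pq}(v_{ij}, w_{kl}))`, rows indexed by `((i,k),p)`. -/
def formAmpl {p m : ℕ} (a : Matrix (Fin p) (Fin p) (ProjCompl (V →L[ℂ] ℂ) (W →L[ℂ] ℂ)))
    (v : Matrix (Fin m) (Fin m) V) (w : Matrix (Fin m) (Fin m) W) :
    Matrix ((Fin m × Fin m) × Fin p) ((Fin m × Fin m) × Fin p) ℂ :=
  Matrix.of fun s t => psiForm V W (a s.2 t.2) (v s.1.1 t.1.1) (w s.1.2 t.1.2)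

/-- The scalar stage: `V* ⊗^ W*` maps completely contractively into the jointly completely bounded
forms. The reason is that `f ∈ M_P(V*)` and `g ∈ M_Q(W*)` in the unit balls are complete
contractions into scalar matrices, and the Kronecker product of two contractions is a contraction.
-/
theorem sNorm_formAmpl_le {p m : ℕ}
    (a : Matrix (Fin p) (Fin p) (ProjCompl (V →L[ℂ] ℂ) (W →L[ℂ] ℂ)))
    {v : Matrix (Fin m) (Fin m) V} {w : Matrix (Fin m) (Fin m) W} (hv : mnorm m v ≤ 1)
    (hw : mnorm m w ≤ 1) : sNorm (formAmpl a v w) ≤ mnorm p a := by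
  refine coeM_denseRange.induction_on
    (p := fun a : Matrix (Fin p) (Fin p) (ProjCompl (V →L[ℂ] ℂ) (W →L[ℂ] ℂ)) =>
      sNorm (formAmpl a v w) ≤ mnorm p a) a ?_ ?_
  · refine isClosed_le (sNorm_continuous.comp ?_) complNorm_continuous
    refine continuous_matrix fun s t => ?_
    have h := (continuous_id (X := Matrix (Fin p) (Fin p)
      (ProjCompl (V →L[ℂ] ℂ) (W →L[ℂ] ℂ)))).matrix_elem s.2 t.2
    exact (((psiForm V W).continuous.comp h).clm_apply continuous_const).clm_apply continuous_const
  intro u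
  have hu : mnorm p (coeM u) = mnorm p u := (complNorm_coe u).trans (nrm_fin u)
  rw [hu]
  refine le_of_forall_gt_imp_ge_of_dense fun c hc => ?_
  have hc0 : 0 ≤ c := (isSeminorm.nonneg p u).trans hc.le
  obtain ⟨P, Q, α, f, g, β, hu, hf, hg, hα, hβ⟩ :=
    exists_rep_of_lt (V := V →L[ℂ] ℂ) (W := W →L[ℂ] ℂ) (u := u) hc
  -- The values of `α (f ⊗ g) β` are a compression of `⟨f, v⟩ ⊗ ⟨g, w⟩`. The Kronecker product pairs
  -- each functional index with its own vector index, whereas `formAmpl` groups the vector indices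
  -- together, hence the `submatrix`.
  have e : formAmpl (coeM u) v w
      = kroneckerMap (· * ·) (1 : Matrix (Fin m × Fin m) (Fin m × Fin m) ℂ) α *
        (kroneckerMap (· * ·) (pairing f v) (pairing g w)).submatrix
          (fun s : (Fin m × Fin m) × (Fin P × Fin Q) => ((s.2.1, s.1.1), (s.2.2, s.1.2)))
          (fun s : (Fin m × Fin m) × (Fin P × Fin Q) => ((s.2.1, s.1.1), (s.2.2, s.1.2))) *
        kroneckerMap (· * ·) (1 : Matrix (Fin m × Fin m) (Fin m × Fin m) ℂ) β := by
    ext ⟨⟨i, k⟩, r⟩ ⟨⟨j, l⟩, r'⟩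
    have h1 : u r r' = ∑ y, ∑ z, (α r y * β z r') •
        (f y.1 z.1 ⊗ₜ[ℂ] g y.2 z.2 : (V →L[ℂ] ℂ) ⊗[ℂ] (W →L[ℂ] ℂ)) :=
      congrFun (congrFun hu r) r'
    -- `ProjTensor` agrees with the algebraic tensor product only after unfolding, so linearity is
    -- supplied as explicit terms.
    have h2 : psiForm₀ V W (u r r') = ∑ y, ∑ z, (α r y * β z r') •
        psiForm₀ V W (f y.1 z.1 ⊗ₜ[ℂ] g y.2 z.2 : (V →L[ℂ] ℂ) ⊗[ℂ] (W →L[ℂ] ℂ)) := by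
      rw [h1]
      refine (map_sum (psiForm₀ V W) _ _).trans (Finset.sum_congr rfl fun y _ => ?_)
      refine (map_sum (psiForm₀ V W) _ _).trans (Finset.sum_congr rfl fun z _ => ?_)
      exact map_smul (psiForm₀ V W) _ _
    have h3 : formAmpl (coeM u) v w ((i, k), r) ((j, l), r')
        = ∑ y, ∑ z, (α r y * β z r') * (f y.1 z.1 (v i j) * g y.2 z.2 (w k l)) := by
      have h4 : formAmpl (coeM u) v w ((i, k), r) ((j, l), r')
          = psiForm₀ V W (u r r') (v i j) (w k l) :=
        congrArg (fun φ => φ (v i j) (w k l)) (psiForm_coe V W (u r r'))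
      rw [h4, h2]
      simp only [_root_.sum_apply, _root_.smul_apply, smul_eq_mul]
      refine Finset.sum_congr rfl fun y _ => Finset.sum_congr rfl fun z _ => ?_
      rw [psiForm₀_tmul]
    rw [h3]
    simp only [Matrix.mul_apply, Fintype.sum_prod_type (f := fun s : (Fin m × Fin m) × _ => _),
      kroneckerMap_apply, Matrix.one_apply, ite_mul, one_mul, zero_mul, mul_ite, mul_zero,
      submatrix_apply, pairing, Matrix.of_apply, Finset.sum_ite_irrel, Finset.sum_const_zero,
      Finset.sum_ite_eq, Finset.sum_ite_eq', Finset.mem_univ, if_true, Finset.sum_mul]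
    rw [Finset.sum_comm]
    refine Finset.sum_congr rfl fun y _ => Finset.sum_congr rfl fun z _ => ?_
    ring
  rw [e]
  have hinj : Function.Injective
      (fun s : (Fin m × Fin m) × (Fin P × Fin Q) => ((s.2.1, s.1.1), (s.2.2, s.1.2))) := by
    rintro ⟨⟨a, b⟩, c, d⟩ ⟨⟨a', b'⟩, c', d'⟩ h
    simp only [Prod.mk.injEq] at h
    simp [h]
  -- The regrouping is injective between sets of equal cardinality, hence a bijection, and
  -- reindexing by a bijection preserves the operator norm.
  let E : (Fin m × Fin m) × (Fin P × Fin Q) ≃ (Fin P × Fin m) × (Fin Q × Fin m) :=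
    Equiv.ofBijective _ ((Fintype.bijective_iff_injective_and_card _).2 ⟨hinj, by
      simp only [Fintype.card_prod, Fintype.card_fin]; ring⟩)
  have h1 := (sNorm_one_kron_le (μ := Fin m × Fin m) α).trans hα
  have h2 := (sNorm_one_kron_le (μ := Fin m × Fin m) β).trans hβ
  have hfv : sNorm (pairing f v) ≤ 1 := (sNorm_pairing_le_dualNorm f v).trans
    (mul_le_one₀ hf (isSeminorm.nonneg _ _) hv)
  have hgw : sNorm (pairing g w) ≤ 1 := (sNorm_pairing_le_dualNorm g w).trans
    (mul_le_one₀ hg (isSeminorm.nonneg _ _) hw)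
  have h3 : sNorm ((kroneckerMap (· * ·) (pairing f v) (pairing g w)).submatrix E E) ≤ 1 := by
    rw [sNorm_submatrix_eq]
    exact (sNorm_kron_le _ _).trans (mul_le_one₀ hfv (sNorm_nonneg _) hgw)
  have hs := Real.sqrt_nonneg c
  refine (sNorm_mul _ _).trans ?_
  refine (mul_le_mul ((sNorm_mul _ _).trans (mul_le_mul h1 h3 (sNorm_nonneg _) hs)) h2
    (sNorm_nonneg _) (by positivity)).trans ?_
  rw [mul_one, Real.mul_self_sqrt hc0]

variable [CompleteSpace X]

/-- The vector stage repeats the scalar one with `(V* ⊗^ W*) ⊗^ X`: for `u = α (a ⊗ x) β` the scalar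
matrix `formAmpl a v w` is a contraction by `sNorm_formAmpl_le`, and its product with `x` is
controlled by `nrm_scalar_kron_le`. -/
theorem nrm_ampl_Psi_le {n m : ℕ}
    (u : Matrix (Fin n) (Fin n) (ProjCompl (ProjCompl (V →L[ℂ] ℂ) (W →L[ℂ] ℂ)) X))
    {v : Matrix (Fin m) (Fin m) V} {w : Matrix (Fin m) (Fin m) W} (hv : mnorm m v ≤ 1)
    (hw : mnorm m w ≤ 1) : nrm _ (ampl (u.map (Psi V W X)) v w) ≤ mnorm n u := by
  refine coeM_denseRange.induction_on
    (p := fun u : Matrix (Fin n) (Fin n) (ProjCompl (ProjCompl (V →L[ℂ] ℂ) (W →L[ℂ] ℂ)) X) =>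
      nrm _ (ampl (u.map (Psi V W X)) v w) ≤ mnorm n u) u ?_ ?_
  · refine isClosed_le (nrm_continuous.comp ?_) complNorm_continuous
    refine continuous_matrix fun s t => ?_
    have h := (continuous_id (X := Matrix (Fin n) (Fin n)
      (ProjCompl (ProjCompl (V →L[ℂ] ℂ) (W →L[ℂ] ℂ)) X))).matrix_elem s.2 t.2
    exact (((Psi V W X).continuous.comp h).clm_apply continuous_const).clm_apply continuous_const
  intro u
  have hu : mnorm n (coeM u) = mnorm n u := (complNorm_coe u).trans (nrm_fin u)
  rw [hu]
  refine le_of_forall_gt_imp_ge_of_dense fun c hc => ?_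
  have hc0 : 0 ≤ c := (isSeminorm.nonneg n u).trans hc.le
  obtain ⟨P, Q, α, a, x, β, hu, ha, hx, hα, hβ⟩ :=
    exists_rep_of_lt (V := ProjCompl (V →L[ℂ] ℂ) (W →L[ℂ] ℂ)) (W := X) (u := u) hc
  have e : ampl ((coeM u).map (Psi V W X)) v w
      = sand (kroneckerMap (· * ·) (1 : Matrix (Fin m × Fin m) (Fin m × Fin m) ℂ) α)
        -- The index of `formAmpl a v w` contains the first component of the inner index of `α`, and
        -- `x` carries the second; reassociating the triple product matches the columns of `1 ⊗ α`.
        ((Matrix.of fun s t : ((Fin m × Fin m) × Fin P) × Fin Q =>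
          formAmpl a v w s.1 t.1 • x s.2 t.2).submatrix
            (Equiv.prodAssoc _ _ _).symm (Equiv.prodAssoc _ _ _).symm)
        (kroneckerMap (· * ·) (1 : Matrix (Fin m × Fin m) (Fin m × Fin m) ℂ) β) := by
    ext ⟨⟨i, k⟩, r⟩ ⟨⟨j, l⟩, r'⟩
    have h1 : u r r' = ∑ y, ∑ z, (α r y * β z r') •
        (a y.1 z.1 ⊗ₜ[ℂ] x y.2 z.2 : ProjCompl (V →L[ℂ] ℂ) (W →L[ℂ] ℂ) ⊗[ℂ] X) :=
      congrFun (congrFun hu r) r'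
    have h2 : psi₀ V W X (u r r') = ∑ y, ∑ z, (α r y * β z r') •
        psi₀ V W X (a y.1 z.1 ⊗ₜ[ℂ] x y.2 z.2 :
          ProjCompl (V →L[ℂ] ℂ) (W →L[ℂ] ℂ) ⊗[ℂ] X) := by
      rw [h1]
      refine (map_sum (psi₀ V W X) _ _).trans (Finset.sum_congr rfl fun y _ => ?_)
      refine (map_sum (psi₀ V W X) _ _).trans (Finset.sum_congr rfl fun z _ => ?_)
      exact map_smul (psi₀ V W X) _ _
    have h3 : ampl ((coeM u).map (Psi V W X)) v w ((i, k), r) ((j, l), r')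
        = ∑ y, ∑ z, (α r y * β z r') • (psiForm V W (a y.1 z.1) (v i j) (w k l) • x y.2 z.2) := by
      have h4 : ampl ((coeM u).map (Psi V W X)) v w ((i, k), r) ((j, l), r')
          = psi₀ V W X (u r r') (v i j) (w k l) :=
        congrArg (fun φ => φ (v i j) (w k l)) (Psi_coe V W X (u r r'))
      rw [h4, h2]
      simp only [_root_.sum_apply, _root_.smul_apply]
      refine Finset.sum_congr rfl fun y _ => Finset.sum_congr rfl fun z _ => ?_
      rw [psi₀_tmul]
    rw [h3]
    simp only [sand, Matrix.of_apply, Fintype.sum_prod_type (f := fun s : (Fin m × Fin m) × _ => _),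
      kroneckerMap_apply, Matrix.one_apply, ite_mul, one_mul, zero_mul, mul_ite, mul_zero,
      submatrix_apply, formAmpl, Finset.sum_ite_irrel, Finset.sum_const_zero, ite_smul, zero_smul,
      Finset.sum_ite_eq, Finset.sum_ite_eq', Finset.mem_univ, if_true, Equiv.prodAssoc_symm_apply]
  rw [e]
  have h1 := (sNorm_one_kron_le (μ := Fin m × Fin m) α).trans hα
  have h2 := (sNorm_one_kron_le (μ := Fin m × Fin m) β).trans hβ
  have h3 := nrm_scalar_kron_le (formAmpl a v w) x
  have h4 : sNorm (formAmpl a v w) * nrm _ x ≤ 1 := by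
    rw [nrm_fin]
    exact mul_le_one₀ ((sNorm_formAmpl_le a hv hw).trans ha) (isSeminorm.nonneg _ _) hx
  have hs := Real.sqrt_nonneg c
  refine (ruan.sand _ _ _ _ _).trans ?_
  rw [ruan.submatrix_equiv]
  refine (mul_le_mul (mul_le_mul h1 (h3.trans h4) (ruan.nonneg _ _) hs) h2
    (sNorm_nonneg _) (by positivity)).trans ?_
  rw [mul_one, Real.mul_self_sqrt hc0]

/-- Each preimage of `Φ` bounds the `jcb` norm, hence so does the infimum. Without a preimage the
right side is `⊤`. -/
theorem jcbNorm_le_nuclearNorm {n : ℕ} (Φ : Matrix (Fin n) (Fin n) (V →L[ℂ] W →L[ℂ] X)) :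
    jcbNorm Φ ≤ nuclearNorm Φ := by
  refine le_iInf fun u => le_iInf fun hu => ?_
  subst hu
  refine iSup_le fun m => iSup_le fun v => iSup_le fun w => iSup_le fun hv => iSup_le fun hw => ?_
  exact ENNReal.ofReal_le_ofReal (nrm_ampl_Psi_le u hv hw)

/-- Testing on `v`, `w` involves only the spans of their finitely many entries, and there the
nuclear norm dominates. -/
theorem jcbNorm_le_integralNorm {n : ℕ} (Φ : Matrix (Fin n) (Fin n) (V →L[ℂ] W →L[ℂ] X)) :
    jcbNorm Φ ≤ integralNorm Φ := by
  refine iSup_le fun m => iSup_le fun v => iSup_le fun w => iSup_le fun hv => iSup_le fun hw => ?_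
  let F₁ : Submodule ℂ V := Submodule.span ℂ (Set.range fun p : Fin m × Fin m => v p.1 p.2)
  let F₂ : Submodule ℂ W := Submodule.span ℂ (Set.range fun p : Fin m × Fin m => w p.1 p.2)
  have h₁ : FiniteDimensional ℂ F₁ := FiniteDimensional.span_of_finite ℂ (Set.finite_range _)
  have h₂ : FiniteDimensional ℂ F₂ := FiniteDimensional.span_of_finite ℂ (Set.finite_range _)
  let v' : Matrix (Fin m) (Fin m) F₁ :=
    Matrix.of fun i j => ⟨v i j, Submodule.subset_span ⟨(i, j), rfl⟩⟩
  let w' : Matrix (Fin m) (Fin m) F₂ :=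
    Matrix.of fun i j => ⟨w i j, Submodule.subset_span ⟨(i, j), rfl⟩⟩
  -- The matrix norms of a subspace are by definition those of the ambient space, so `v'`, `w'` stay
  -- in the unit balls and give the same matrix of values.
  have h3 : ENNReal.ofReal (nrm _ (ampl Φ v w)) ≤ jcbNorm (Φ.map (restr F₁ F₂)) :=
    le_iSup_of_le m (le_iSup_of_le v' (le_iSup_of_le w' (le_iSup_of_le hv
      (le_iSup_of_le hw le_rfl))))
  refine h3.trans ((jcbNorm_le_nuclearNorm _).trans ?_)
  exact le_iSup_of_le F₁ (le_iSup_of_le F₂ (le_iSup_of_le h₁ (le_iSup_of_le h₂ le_rfl)))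

end Jcb

/-! ### Matrix norm axioms for extended real valued matrix norms -/

section Axioms

theorem dsum_map {E F : Type*} [Zero E] [Zero F] (f : E → F) (hf : f 0 = 0) {n m : ℕ}
    (v : Matrix (Fin n) (Fin n) E) (w : Matrix (Fin m) (Fin m) E) :
    (dsum v w).map f = dsum (v.map f) (w.map f) := by
  ext i j
  obtain ⟨i, rfl⟩ := finSumFinEquiv.surjective i
  obtain ⟨j, rfl⟩ := finSumFinEquiv.surjective j
  rcases i with i | i <;> rcases j with j | j <;> simp [dsum, hf]

variable {E : Type*} [AddCommGroup E] [Module ℂ E]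

/-- Used to bound a matrix entry by entry: a matrix with one nonzero entry is a compression of a `1
× 1` matrix, so M2 applies to it. -/
theorem single_eq_sand {ι : Type} [Fintype ι] [DecidableEq ι] (i j : ι) (x : E) :
    Matrix.single i j x
      = sand (pick fun _ : Fin 1 => i)ᵀ (oneMat x) (pick fun _ : Fin 1 => j) := by
  ext a b
  by_cases ha : i = a <;> by_cases hb : j = b <;>
    simp [sand, pick, Matrix.single, ha, hb, oneMat]

/-- Extended real valued matrix norms that are finite on the matrices over a subspace `A` and
satisfy the upper estimates in the axioms of an operator space are matrix seminorms on `A`. -/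
theorem isOperatorSpaceSeminorm_toReal (A : Submodule ℂ E)
    (N : ∀ n : ℕ, Matrix (Fin n) (Fin n) E → ENNReal)
    (fin : ∀ (n : ℕ) (v : Matrix (Fin n) (Fin n) E), (∀ i j, v i j ∈ A) → N n v ≠ ⊤)
    (add : ∀ (n : ℕ) (v w : Matrix (Fin n) (Fin n) E), N n (v + w) ≤ N n v + N n w)
    (smul : ∀ (n : ℕ) (c : ℂ) (v : Matrix (Fin n) (Fin n) E),
      N n (c • v) ≤ ENNReal.ofReal ‖c‖ * N n v)
    (dsum_le : ∀ (n m : ℕ) (v : Matrix (Fin n) (Fin n) E) (w : Matrix (Fin m) (Fin m) E),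
      N (n + m) (dsum v w) ≤ max (N n v) (N m w))
    (sand_le : ∀ (n m : ℕ) (α : Matrix (Fin m) (Fin n) ℂ) (v : Matrix (Fin n) (Fin n) E)
      (β : Matrix (Fin n) (Fin m) ℂ), N n v ≠ ⊤ →
        N m (sand α v β) ≤ ENNReal.ofReal (sNorm α * sNorm β) * N n v) :
    IsOperatorSpaceSeminorm fun n (v : Matrix (Fin n) (Fin n) A) =>
      (N n (v.map fun x => (x : E))).toReal := by
  have fin' : ∀ (n : ℕ) (v : Matrix (Fin n) (Fin n) A), N n (v.map fun x => (x : E)) ≠ ⊤ :=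
    fun n v => fin n _ fun i j => (v i j).2
  have sand' : ∀ (n m : ℕ) (α : Matrix (Fin m) (Fin n) ℂ) (v : Matrix (Fin n) (Fin n) A)
      (β : Matrix (Fin n) (Fin m) ℂ), (N m ((sand α v β).map fun x => (x : E))).toReal
        ≤ sNorm α * (N n (v.map fun x => (x : E))).toReal * sNorm β := by
    intro n m α v β
    have e : (sand α v β).map (fun x => (x : E)) = sand α (v.map fun x => (x : E)) β :=
      sand_map A.subtype α v β
    rw [e]
    have h := ENNReal.toReal_mono (ENNReal.mul_ne_top ENNReal.ofReal_ne_top (fin' n v))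
      (sand_le n m α _ β (fin' n v))
    rw [ENNReal.toReal_mul, ENNReal.toReal_ofReal
      (mul_nonneg (sNorm_nonneg _) (sNorm_nonneg _))] at h
    exact h.trans (by ring_nf; rfl)
  -- A principal submatrix is a compression by `0`-`1` matrices of norm at most one. This yields the
  -- lower estimate in M1.
  have sub : ∀ (n m : ℕ) (f : Fin m → Fin n) (_ : Function.Injective f)
      (v : Matrix (Fin n) (Fin n) A), (N m ((v.submatrix f f).map fun x => (x : E))).toReal
        ≤ (N n (v.map fun x => (x : E))).toReal := by
    intro n m f hf v
    rw [submatrix_eq_sand]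
    refine (sand' n m _ v _).trans ?_
    have h1 := sNorm_pick_le hf
    have h2 := sNorm_pickT_le hf
    have n1 := sNorm_nonneg (pick f)
    have n2 := sNorm_nonneg (pick f)ᵀ
    have n3 : 0 ≤ (N n (v.map fun x => (x : E))).toReal := ENNReal.toReal_nonneg
    calc _ ≤ 1 * (N n (v.map fun x => (x : E))).toReal * 1 := by gcongr
      _ = _ := by ring
  have smul' : ∀ (n : ℕ) (c : ℂ) (v : Matrix (Fin n) (Fin n) A),
      (N n ((c • v).map fun x => (x : E))).toReal
        ≤ ‖c‖ * (N n (v.map fun x => (x : E))).toReal := by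
    intro n c v
    have h := ENNReal.toReal_mono (ENNReal.mul_ne_top ENNReal.ofReal_ne_top (fin' n v))
      (smul n c (v.map fun x => (x : E)))
    rw [ENNReal.toReal_mul, ENNReal.toReal_ofReal (norm_nonneg _)] at h
    exact h
  refine ⟨fun n v w => ?_, fun n c v => ?_, fun n m v w => ?_, sand'⟩
  · have h := ENNReal.toReal_mono (ENNReal.add_ne_top.2 ⟨fin' n v, fin' n w⟩) (add n _ _)
    rwa [ENNReal.toReal_add (fin' n v) (fin' n w)] at h
  · refine le_antisymm (smul' n c v) ?_
    by_cases hc : c = 0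
    · rw [hc, norm_zero, zero_mul]
      exact ENNReal.toReal_nonneg
    · have hc' : 0 < ‖c‖ := norm_pos_iff.2 hc
      -- The reverse inequality is the upper estimate applied to `c⁻¹` and `c • v`.
      have h := smul' n c⁻¹ (c • v)
      rw [smul_smul, inv_mul_cancel₀ hc, one_smul, norm_inv] at h
      rwa [le_inv_mul_iff₀ hc'] at h
  · refine le_antisymm ?_ (max_le ?_ ?_)
    · rw [← ENNReal.toReal_max (fin' n v) (fin' m w)]
      refine ENNReal.toReal_mono ?_ ?_
      · exact (max_lt (fin' n v).lt_top (fin' m w).lt_top).ne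
      · rw [dsum_map _ rfl]
        exact dsum_le n m _ _
    · have e : (dsum v w).submatrix (Fin.castAdd m) (Fin.castAdd m) = v := by
        ext i j
        simp [dsum]
      conv_lhs => rw [← e]
      exact sub _ _ _ (Fin.castAdd_injective n m) _
    · have e : (dsum v w).submatrix (Fin.natAdd n) (Fin.natAdd n) = w := by
        ext i j
        simp [dsum]
      conv_lhs => rw [← e]
      exact sub _ _ _ (Fin.natAdd_injective m n) _

end Axioms

/-! ### The ideals of completely nuclear and completely integral maps -/

section Ideals

variable {V W X U₁ U₂ Y : Type*} [NormedAddCommGroup V] [NormedSpace ℂ V] [OperatorSpace V]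
  [NormedAddCommGroup W] [NormedSpace ℂ W] [OperatorSpace W]
  [NormedAddCommGroup X] [NormedSpace ℂ X] [OperatorSpace X] [CompleteSpace X]
  [NormedAddCommGroup U₁] [NormedSpace ℂ U₁] [OperatorSpace U₁]
  [NormedAddCommGroup U₂] [NormedSpace ℂ U₂] [OperatorSpace U₂]
  [NormedAddCommGroup Y] [NormedSpace ℂ Y] [OperatorSpace Y] [CompleteSpace Y]
  {n m : ℕ}

theorem nuclearNorm_Psi_le
    (u : Matrix (Fin n) (Fin n) (ProjCompl (ProjCompl (V →L[ℂ] ℂ) (W →L[ℂ] ℂ)) X)) :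
    nuclearNorm (u.map (Psi V W X)) ≤ ENNReal.ofReal (mnorm n u) :=
  iInf₂_le_of_le u rfl le_rfl

/-- Preimages can be chosen entry by entry and assembled into one matrix, whose norm is finite. -/
theorem nuclearNorm_lt_top {Φ : Matrix (Fin n) (Fin n) (V →L[ℂ] W →L[ℂ] X)}
    (h : ∀ i j, Φ i j ∈ nuclear V W X) : nuclearNorm Φ < ⊤ := by
  choose u hu using h
  have e : (Matrix.of u).map (Psi V W X) = Φ := by
    ext1 i j
    exact hu i j
  rw [← e]
  exact (nuclearNorm_Psi_le _).trans_lt ENNReal.ofReal_lt_top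

/-- Transfers a bound valid for every preimage to the infimum. Finiteness is needed when `C = 0`: as
`0 * ⊤ = 0`, the claim is then that `Φ'` has norm zero, and only an actual preimage of `Φ` provides
that. -/
theorem nuclearNorm_le_mul {Φ : Matrix (Fin n) (Fin n) (V →L[ℂ] W →L[ℂ] X)}
    {Φ' : Matrix (Fin m) (Fin m) (U₁ →L[ℂ] U₂ →L[ℂ] Y)} {C : ℝ} (hC : 0 ≤ C)
    (hΦ : nuclearNorm Φ ≠ ⊤)
    (h : ∀ u : Matrix (Fin n) (Fin n) (ProjCompl (ProjCompl (V →L[ℂ] ℂ) (W →L[ℂ] ℂ)) X),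
      u.map (Psi V W X) = Φ → nuclearNorm Φ' ≤ ENNReal.ofReal (C * mnorm n u)) :
    nuclearNorm Φ' ≤ ENNReal.ofReal C * nuclearNorm Φ := by
  rcases hC.eq_or_lt with rfl | hC
  · have hne : ∃ u : Matrix (Fin n) (Fin n) (ProjCompl (ProjCompl (V →L[ℂ] ℂ) (W →L[ℂ] ℂ)) X),
        u.map (Psi V W X) = Φ := by
      -- Without preimages the infimum is over the empty set, thus `⊤`.
      by_contra! hcon
      exact hΦ (by simp [nuclearNorm, hcon])
    obtain ⟨u, hu⟩ := hne
    simpa using h u hu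
  · have h0 : ENNReal.ofReal C ≠ 0 := by simpa using hC
    rw [nuclearNorm.eq_def Φ, ENNReal.mul_iInf_of_ne h0 ENNReal.ofReal_ne_top]
    refine le_iInf fun u => ?_
    rw [ENNReal.mul_iInf_of_ne h0 ENNReal.ofReal_ne_top]
    refine le_iInf fun hu => ?_
    rw [← ENNReal.ofReal_mul hC.le]
    exact h u hu

/-- `Ψ` is linear, so a compression of a preimage is a preimage of the compression; M2 holds
upstairs. -/
theorem nuclearNorm_sand_le (α : Matrix (Fin m) (Fin n) ℂ)
    (Φ : Matrix (Fin n) (Fin n) (V →L[ℂ] W →L[ℂ] X)) (β : Matrix (Fin n) (Fin m) ℂ)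
    (hΦ : nuclearNorm Φ ≠ ⊤) :
    nuclearNorm (sand α Φ β) ≤ ENNReal.ofReal (sNorm α * sNorm β) * nuclearNorm Φ := by
  refine nuclearNorm_le_mul (mul_nonneg (sNorm_nonneg _) (sNorm_nonneg _)) hΦ fun u hu => ?_
  rw [← hu, ← sand_map]
  refine (nuclearNorm_Psi_le _).trans (ENNReal.ofReal_le_ofReal ?_)
  exact (isSeminorm.sand _ _ _ _ _).trans (by ring_nf; rfl)

/-- The direct sum of two nearly optimal preimages is a preimage of the direct sum, and M1 holds
upstairs. -/
theorem nuclearNorm_dsum_le (Φ : Matrix (Fin n) (Fin n) (V →L[ℂ] W →L[ℂ] X))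
    (Φ' : Matrix (Fin m) (Fin m) (V →L[ℂ] W →L[ℂ] X)) :
    nuclearNorm (dsum Φ Φ') ≤ max (nuclearNorm Φ) (nuclearNorm Φ') := by
  refine le_of_forall_gt_imp_ge_of_dense fun c hc => ?_
  obtain ⟨h₁, h₂⟩ := max_lt_iff.1 hc
  simp only [nuclearNorm, iInf_lt_iff] at h₁ h₂
  obtain ⟨u, hu, huc⟩ := h₁
  obtain ⟨u', hu', huc'⟩ := h₂
  rw [← hu, ← hu', ← dsum_map _ (map_zero _)]
  refine (nuclearNorm_Psi_le _).trans ?_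
  rw [isSeminorm.dsum, ENNReal.ofReal_max]
  exact max_le huc.le huc'.le

/-- The map of `exists_lift_comp3` sends preimages of `Φ` to preimages of the composition. -/
theorem nuclearNorm_comp3_le {r₁ : U₁ →L[ℂ] V} {r₂ : U₂ →L[ℂ] W} {s : X →L[ℂ] Y} {a b c : ℝ}
    (h₁ : CBBound r₁ a) (h₂ : CBBound r₂ b) (hs : CBBound s c)
    (Φ : Matrix (Fin n) (Fin n) (V →L[ℂ] W →L[ℂ] X)) (hΦ : nuclearNorm Φ ≠ ⊤) :
    nuclearNorm (Φ.map fun φ => comp3 s φ r₁ r₂) ≤ ENNReal.ofReal (a * b * c) * nuclearNorm Φ := by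
  obtain ⟨R, hR, hR'⟩ := exists_lift_comp3 h₁ h₂ hs
  refine nuclearNorm_le_mul hR.nonneg hΦ fun u hu => ?_
  have e : Φ.map (fun φ => comp3 s φ r₁ r₂) = (u.map R).map (Psi U₁ U₂ Y) := by
    ext1 i j
    simp [← hu, hR']
  rw [e]
  exact (nuclearNorm_Psi_le _).trans (ENNReal.ofReal_le_ofReal (hR.le _ _))

theorem comp3_mem_nuclear {r₁ : U₁ →L[ℂ] V} {r₂ : U₂ →L[ℂ] W} {s : X →L[ℂ] Y} {a b c : ℝ}
    (h₁ : CBBound r₁ a) (h₂ : CBBound r₂ b) (hs : CBBound s c) {φ : V →L[ℂ] W →L[ℂ] X}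
    (hφ : φ ∈ nuclear V W X) : comp3 s φ r₁ r₂ ∈ nuclear U₁ U₂ Y := by
  obtain ⟨u, rfl⟩ := hφ
  obtain ⟨R, -, hR⟩ := exists_lift_comp3 h₁ h₂ hs
  exact ⟨R u, hR u⟩

theorem nuclearNorm_restr_le_integralNorm (Φ : Matrix (Fin n) (Fin n) (V →L[ℂ] W →L[ℂ] X))
    (F₁ : Submodule ℂ V) (F₂ : Submodule ℂ W) (h₁ : FiniteDimensional ℂ F₁)
    (h₂ : FiniteDimensional ℂ F₂) : nuclearNorm (Φ.map (restr F₁ F₂)) ≤ integralNorm Φ :=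
  le_iSup_of_le F₁ (le_iSup_of_le F₂ (le_iSup_of_le h₁ (le_iSup_of_le h₂ le_rfl)))

theorem integralNorm_le {Φ : Matrix (Fin n) (Fin n) (V →L[ℂ] W →L[ℂ] X)} {C : ENNReal}
    (h : ∀ (F₁ : Submodule ℂ V) (F₂ : Submodule ℂ W), FiniteDimensional ℂ F₁ →
      FiniteDimensional ℂ F₂ → nuclearNorm (Φ.map (restr F₁ F₂)) ≤ C) : integralNorm Φ ≤ C :=
  iSup_le fun F₁ => iSup_le fun F₂ => iSup_le fun h₁ => iSup_le fun h₂ => h F₁ F₂ h₁ h₂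

/-- Restriction is composition with two inclusions and the identity, all completely contractive. -/
theorem integralNorm_le_nuclearNorm (Φ : Matrix (Fin n) (Fin n) (V →L[ℂ] W →L[ℂ] X)) :
    integralNorm Φ ≤ nuclearNorm Φ := by
  by_cases hΦ : nuclearNorm Φ = ⊤
  · rw [hΦ]
    exact le_top
  refine integralNorm_le fun F₁ F₂ _ _ => ?_
  have h := nuclearNorm_comp3_le (CBBound.subtypeL F₁) (CBBound.subtypeL F₂)
    (CBBound.id (V := X)) Φ hΦ
  rw [one_mul, one_mul, ENNReal.ofReal_one, one_mul] at h
  exact h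

theorem integralNorm_sand_le (α : Matrix (Fin m) (Fin n) ℂ)
    (Φ : Matrix (Fin n) (Fin n) (V →L[ℂ] W →L[ℂ] X)) (β : Matrix (Fin n) (Fin m) ℂ)
    (hΦ : integralNorm Φ ≠ ⊤) :
    integralNorm (sand α Φ β) ≤ ENNReal.ofReal (sNorm α * sNorm β) * integralNorm Φ := by
  refine integralNorm_le fun F₁ F₂ h₁ h₂ => ?_
  -- Bundled as a linear map so that `sand_map` moves the restriction past the scalar matrices.
  let L : (V →L[ℂ] W →L[ℂ] X) →ₗ[ℂ] (F₁ →L[ℂ] F₂ →L[ℂ] X) :=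
    { toFun := restr F₁ F₂, map_add' := fun _ _ => rfl, map_smul' := fun _ _ => rfl }
  have e : (sand α Φ β).map (restr F₁ F₂) = sand α (Φ.map (restr F₁ F₂)) β := sand_map L α Φ β
  have hle := nuclearNorm_restr_le_integralNorm Φ F₁ F₂ h₁ h₂
  rw [e]
  refine (nuclearNorm_sand_le _ _ _ (ne_top_of_le_ne_top hΦ hle)).trans ?_
  gcongr

theorem integralNorm_dsum_le (Φ : Matrix (Fin n) (Fin n) (V →L[ℂ] W →L[ℂ] X))
    (Φ' : Matrix (Fin m) (Fin m) (V →L[ℂ] W →L[ℂ] X)) :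
    integralNorm (dsum Φ Φ') ≤ max (integralNorm Φ) (integralNorm Φ') := by
  refine integralNorm_le fun F₁ F₂ h₁ h₂ => ?_
  rw [dsum_map (restr F₁ F₂) rfl]
  exact (nuclearNorm_dsum_le _ _).trans (max_le_max
    (nuclearNorm_restr_le_integralNorm Φ F₁ F₂ h₁ h₂)
    (nuclearNorm_restr_le_integralNorm Φ' F₁ F₂ h₁ h₂))

/-- The images `r₁ F₁` and `r₂ F₂` are again finite-dimensional, and the composition restricted to
`F₁ × F₂` sees `Φ` only there. The corestricted maps keep the constants `a` and `b`, so the nuclear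
estimate applies to the restriction of `Φ`. -/
theorem integralNorm_comp3_le {r₁ : U₁ →L[ℂ] V} {r₂ : U₂ →L[ℂ] W} {s : X →L[ℂ] Y} {a b c : ℝ}
    (h₁ : CBBound r₁ a) (h₂ : CBBound r₂ b) (hs : CBBound s c)
    (Φ : Matrix (Fin n) (Fin n) (V →L[ℂ] W →L[ℂ] X)) (hΦ : integralNorm Φ ≠ ⊤) :
    integralNorm (Φ.map fun φ => comp3 s φ r₁ r₂)
      ≤ ENNReal.ofReal (a * b * c) * integralNorm Φ := by
  refine integralNorm_le fun F₁ F₂ hF₁ hF₂ => ?_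
  let G₁ : Submodule ℂ V := F₁.map r₁.toLinearMap
  let G₂ : Submodule ℂ W := F₂.map r₂.toLinearMap
  have hle := nuclearNorm_restr_le_integralNorm Φ G₁ G₂ inferInstance inferInstance
  have h := nuclearNorm_comp3_le
    (h₁.restrict F₁ G₁ fun x => Submodule.mem_map_of_mem x.2)
    (h₂.restrict F₂ G₂ fun x => Submodule.mem_map_of_mem x.2) hs (Φ.map (restr G₁ G₂))
    (ne_top_of_le_ne_top hΦ hle)
  refine le_trans (le_of_eq ?_) (h.trans (mul_le_mul_right hle _))
  rfl

/-- Membership in `integral` controls each entry separately, while the norm at level `n` is a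
supremum for the whole matrix. Splitting into single-entry matrices and using subadditivity bridges
the gap. -/
theorem integralNorm_lt_top {Φ : Matrix (Fin n) (Fin n) (V →L[ℂ] W →L[ℂ] X)}
    (h : ∀ i j, Φ i j ∈ integral V W X) : integralNorm Φ < ⊤ := by
  have zero : integralNorm (0 : Matrix (Fin n) (Fin n) (V →L[ℂ] W →L[ℂ] X)) < ⊤ :=
    (integralNorm_le_nuclearNorm _).trans_lt (nuclearNorm_lt_top fun _ _ => zero_mem _)
  have add : ∀ v w : Matrix (Fin n) (Fin n) (V →L[ℂ] W →L[ℂ] X), integralNorm v < ⊤ →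
      integralNorm w < ⊤ → integralNorm (v + w) < ⊤ := fun v w hv hw =>
    (integralNorm_add_le v w).trans_lt (ENNReal.add_lt_top.2 ⟨hv, hw⟩)
  rw [Matrix.matrix_eq_sum_single Φ]
  refine Finset.sum_induction _ (fun v => integralNorm v < ⊤) add zero fun i _ =>
    Finset.sum_induction _ (fun v => integralNorm v < ⊤) add zero fun j _ => ?_
  rw [single_eq_sand]
  exact (integralNorm_sand_le _ _ _ (h i j).2.ne).trans_lt
    (ENNReal.mul_lt_top ENNReal.ofReal_lt_top (h i j).2)

/-- Both conditions defining `integral` follow from finiteness of the nuclear norm, which dominates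
the other two norms. -/
theorem nuclear_le_integral : nuclear V W X ≤ integral V W X := by
  intro φ hφ
  have h : nuclearNorm (oneMat φ) < ⊤ := nuclearNorm_lt_top fun _ _ => hφ
  exact ⟨(jcbNorm_le_nuclearNorm _).trans_lt h, (integralNorm_le_nuclearNorm _).trans_lt h⟩

/-- The generator given by `f`, `g`, `x` is the image under `Ψ` of the elementary tensor `(f ⊗ g) ⊗
x`. -/
theorem finiteType_le_nuclear : finiteType V W X ≤ nuclear V W X := by
  refine Submodule.span_le.2 ?_
  rintro _ ⟨f, g, x, rfl⟩
  refine ⟨ptmul (ptmul f g) x, ?_⟩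
  ext v w
  refine (Psi_ptmul _ _ v w).trans ?_
  rw [psiForm_ptmul]
  simp [mul_smul]

/-- The source of definiteness for both norms. Testing on `1 × 1` matrices already shows that each
entry vanishes on the unit balls, and rescaling finishes. -/
theorem eq_zero_of_jcbNorm_eq_zero {Φ : Matrix (Fin n) (Fin n) (V →L[ℂ] W →L[ℂ] X)}
    (h : jcbNorm Φ = 0) : Φ = 0 := by
  have unit : ∀ (i j : Fin n) (v : V) (w : W), ‖v‖ ≤ 1 → ‖w‖ ≤ 1 → Φ i j v w = 0 := by
    intro i j v w hv hw
    have h1 : ENNReal.ofReal (nrm _ (ampl Φ (oneMat v) (oneMat w))) ≤ jcbNorm Φ :=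
      le_iSup_of_le 1 (le_iSup_of_le (oneMat v) (le_iSup_of_le (oneMat w)
        (le_iSup_of_le (by rw [mnorm_one]; exact hv)
          (le_iSup_of_le (by rw [mnorm_one]; exact hw) le_rfl))))
    rw [h, nonpos_iff_eq_zero, ENNReal.ofReal_eq_zero] at h1
    have h2 := norm_entry_le (ampl Φ (oneMat v) (oneMat w)) ((0, 0), i) ((0, 0), j)
    exact norm_le_zero_iff.1 (h2.trans h1)
  ext i j v w
  by_cases hv : v = 0
  · simp [hv]
  by_cases hw : w = 0
  · simp [hw]
  have h1 := unit i j (((‖v‖ : ℂ)⁻¹) • v) (((‖w‖ : ℂ)⁻¹) • w)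
    (by simp [norm_smul, hv]) (by simp [norm_smul, hw])
  simpa [hv, hw] using h1

end Ideals

/-! ### Verification of the ideal axioms -/

theorem isBilinearIdeal_nuclear :
    IsBilinearIdeal.{u} (fun V W X => nuclear V W X) nuclearMatrixNorm where
  le_JCB _ _ _ := nuclear_le_integral.trans fun _ h => h.1
  finiteType_le _ _ _ := finiteType_le_nuclear
  isOperatorSpaceNorm V W X :=
    { isOperatorSpaceSeminorm_toReal (nuclear V W X) (fun _ => nuclearNorm)
        (fun _ _ h => (nuclearNorm_lt_top h).ne) (fun _ => nuclearNorm_add_le)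
        (fun _ => nuclearNorm_smul_le) (fun _ _ => nuclearNorm_dsum_le)
        (fun _ _ => nuclearNorm_sand_le) with
      eq_zero := fun n Φ h => by
        have hfin := nuclearNorm_lt_top (Φ := Φ.map fun φ => (φ : V →L[ℂ] W →L[ℂ] X))
          fun i j => (Φ i j).2
        -- `toReal` vanishes at `⊤` too; finiteness of the norm on `nuclear` excludes that case.
        have h0 := (ENNReal.toReal_eq_zero_iff _).1 h
        have h1 := eq_zero_of_jcbNorm_eq_zero (nonpos_iff_eq_zero.1
          ((jcbNorm_le_nuclearNorm _).trans (h0.resolve_right hfin.ne).le))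
        ext1 i j
        exact Subtype.ext (congrFun (congrFun h1 i) j) }
  jcbNorm_le V W X n Φ := by
    have hfin := nuclearNorm_lt_top (Φ := Φ.map fun φ => (φ : V →L[ℂ] W →L[ℂ] X))
      fun i j => (Φ i j).2
    rw [nuclearMatrixNorm, ENNReal.ofReal_toReal hfin.ne]
    exact jcbNorm_le_nuclearNorm _
  comp_mem _ _ _ _ _ _ _ _ _ h₁ h₂ hs _ hφ :=
    comp3_mem_nuclear (CBBound.of_cbNorm h₁) (CBBound.of_cbNorm h₂) (CBBound.of_cbNorm hs) hφ
  comp_le V W X U₁ U₂ Y r₁ r₂ s h₁ h₂ hs n Φ Φ' h := by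
    have hfin := (nuclearNorm_lt_top (Φ := Φ.map fun φ => (φ : V →L[ℂ] W →L[ℂ] X))
      fun i j => (Φ i j).2).ne
    have h3 := nuclearNorm_comp3_le (CBBound.of_cbNorm h₁) (CBBound.of_cbNorm h₂)
      (CBBound.of_cbNorm hs) _ hfin
    have e : Φ'.map (fun φ => (φ : U₁ →L[ℂ] U₂ →L[ℂ] Y))
        = (Φ.map fun φ => (φ : V →L[ℂ] W →L[ℂ] X)).map fun φ => comp3 s φ r₁ r₂ := by
      ext1 i j
      exact h i j
    rw [← e] at h3
    have h4 := ENNReal.toReal_mono (ENNReal.mul_ne_top ENNReal.ofReal_ne_top hfin) h3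
    rw [ENNReal.toReal_mul, ENNReal.toReal_ofReal (by positivity)] at h4
    exact h4.trans (le_of_eq (by simp only [nuclearMatrixNorm]; ring))

theorem isBilinearIdeal_integral :
    IsBilinearIdeal.{u} (fun V W X => integral V W X) integralMatrixNorm where
  le_JCB _ _ _ := fun _ h => h.1
  finiteType_le _ _ _ := finiteType_le_nuclear.trans nuclear_le_integral
  isOperatorSpaceNorm V W X :=
    { isOperatorSpaceSeminorm_toReal (integral V W X) (fun _ => integralNorm)
        (fun _ _ h => (integralNorm_lt_top h).ne) (fun _ => integralNorm_add_le)
        (fun _ => integralNorm_smul_le) (fun _ _ => integralNorm_dsum_le)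
        (fun _ _ => integralNorm_sand_le) with
      eq_zero := fun n Φ h => by
        have hfin := integralNorm_lt_top (Φ := Φ.map fun φ => (φ : V →L[ℂ] W →L[ℂ] X))
          fun i j => (Φ i j).2
        have h0 := (ENNReal.toReal_eq_zero_iff _).1 h
        have h1 := eq_zero_of_jcbNorm_eq_zero (nonpos_iff_eq_zero.1
          ((jcbNorm_le_integralNorm _).trans (h0.resolve_right hfin.ne).le))
        ext1 i j
        exact Subtype.ext (congrFun (congrFun h1 i) j) }
  jcbNorm_le V W X n Φ := by
    have hfin := integralNorm_lt_top (Φ := Φ.map fun φ => (φ : V →L[ℂ] W →L[ℂ] X))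
      fun i j => (Φ i j).2
    rw [integralMatrixNorm, ENNReal.ofReal_toReal hfin.ne]
    exact jcbNorm_le_integralNorm _
  comp_mem _ _ _ _ _ _ r₁ r₂ s h₁ h₂ hs φ hφ := by
    have h3 : integralNorm (oneMat (comp3 s φ r₁ r₂)) < ⊤ :=
      (integralNorm_comp3_le (CBBound.of_cbNorm h₁) (CBBound.of_cbNorm h₂)
        (CBBound.of_cbNorm hs) (oneMat φ) hφ.2.ne).trans_lt
          (ENNReal.mul_lt_top ENNReal.ofReal_lt_top hφ.2)
    -- Joint complete boundedness of the composition needs no separate argument, being implied by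
    -- its finite integral norm.
    exact ⟨(jcbNorm_le_integralNorm _).trans_lt h3, h3⟩
  comp_le V W X U₁ U₂ Y r₁ r₂ s h₁ h₂ hs n Φ Φ' h := by
    have hfin := (integralNorm_lt_top (Φ := Φ.map fun φ => (φ : V →L[ℂ] W →L[ℂ] X))
      fun i j => (Φ i j).2).ne
    have h3 := integralNorm_comp3_le (CBBound.of_cbNorm h₁) (CBBound.of_cbNorm h₂)
      (CBBound.of_cbNorm hs) _ hfin
    have e : Φ'.map (fun φ => (φ : U₁ →L[ℂ] U₂ →L[ℂ] Y))
        = (Φ.map fun φ => (φ : V →L[ℂ] W →L[ℂ] X)).map fun φ => comp3 s φ r₁ r₂ := by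
      ext1 i j
      exact h i j
    rw [← e] at h3
    have h4 := ENNReal.toReal_mono (ENNReal.mul_ne_top ENNReal.ofReal_ne_top hfin) h3
    rw [ENNReal.toReal_mul, ENNReal.toReal_ofReal (by positivity)] at h4
    exact h4.trans (le_of_eq (by simp only [integralMatrixNorm]; ring))

end OpSp

end

theorem mainTheorem12 :
    OpSp.IsBilinearIdeal.{u} (fun V W X => OpSp.nuclear V W X) OpSp.nuclearMatrixNorm ∧
    OpSp.IsBilinearIdeal.{u} (fun V W X => OpSp.integral V W X) OpSp.integralMatrixNorm ∧
    (∀ V W X : OpSp.COS.{u}, OpSp.nuclear V W X ≤ OpSp.integral V W X) ∧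
    (∀ (V W X : OpSp.COS.{u}) (n : ℕ) (Φ : Matrix (Fin n) (Fin n) (V →L[ℂ] W →L[ℂ] X)),
      (∀ i j, Φ i j ∈ OpSp.nuclear V W X) →
      OpSp.jcbNorm Φ ≤ OpSp.integralNorm Φ ∧ OpSp.integralNorm Φ ≤ OpSp.nuclearNorm Φ ∧
        OpSp.nuclearNorm Φ < ⊤) ∧
    (∀ (V W X : OpSp.COS.{u}) (n : ℕ) (Φ : Matrix (Fin n) (Fin n) (V →L[ℂ] W →L[ℂ] X)),
      (∀ i j, Φ i j ∈ OpSp.integral V W X) →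
      OpSp.jcbNorm Φ ≤ OpSp.integralNorm Φ ∧ OpSp.integralNorm Φ < ⊤) := by
  refine ⟨OpSp.isBilinearIdeal_nuclear, OpSp.isBilinearIdeal_integral,
    fun _ _ _ => OpSp.nuclear_le_integral, fun V W X n Φ h => ?_, fun V W X n Φ h => ?_⟩
  · exact ⟨OpSp.jcbNorm_le_integralNorm Φ, OpSp.integralNorm_le_nuclearNorm Φ,
      OpSp.nuclearNorm_lt_top h⟩
  · exact ⟨OpSp.jcbNorm_le_integralNorm Φ, OpSp.integralNorm_lt_top h⟩
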